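/- Let $n\ge 1$ and let $(M^{2n},\Omega,F)$, $F=(f_1,\dots,f_n)$, be a real-analytic integrable Hamiltonian system: $M$ is a real-analytic manifold, $\Omega$ a real-analytic symplectic form, and $f_1,\dots,f_n$ are real-analytic, pairwise Poisson-commuting functions that are functionally independent on a dense set. $F$ need not be proper and the flows need not be complete. Write $X_f$ for the Hamiltonian vector field of $f$, given by $\Omega(\cdot,X_f)=\mathrm{d}f$, $\operatorname{Sing}(F)=\{m:\operatorname{rank}\mathrm{d}F(m)<n\}$, $L_0=F^{-1}(0)$, and $\mathcal O_m$ for the orbit of $m$ under the local Hamiltonian $\mathbb R^n$-action generated by $f_1,\dots,f_n$. On $L_0\setminus\operatorname{Sing}(F)$ let $\theta_1,\dots,\theta_n$ be the 1-forms dual to the frame $X_{f_1},\dots,X_{f_n}$ of the tangent spaces of $L_0$, and let $\mathrm{d}s^2=\sum_{i=1}^n\theta_i^2$. Let $m_0\in M$ be a point with $F(m_0)=0$ and $\operatorname{rank}\mathrm{d}F(m_0)=0$. Suppose that $\hat\gamma$ is a (piecewise $C^1$) closed curve in $L_0\setminus\operatorname{Sing}(F)$ and $m_1\in\hat\gamma$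 is a point such that (a) $\oint_{\hat\gamma}\theta_1\neq0$; (b) either the flows of all $X_{f_i}$ are complete in $L_0$ and $m_0\in\overline{\mathcal O_{m_1}}$; or there are a coordinate chart $\phi:U\to B_{0,r}$ centred at $m_0$, onto the open ball of radius $r$ about $0$ in $\mathbb R^{2n}$, with $\Omega|_U=\phi^*\sum_{i=1}^n\mathrm{d}x_{2i-1}\wedge\mathrm{d}x_{2i}$, a constant $c>0$ with $|\mathrm{d}(f_i\circ\phi^{-1})(x)|\le c|x|$ for all $x\in B_{0,r}$ and $1\le i\le n$, and a continuous path $m_u\in(L_0\setminus\operatorname{Sing}(F))\cap\phi^{-1}(B_{0,re^{-nc\ell}})$, $0<u\le1$, ending at the given point $m_1$ for $u=1$, such that $m_0\in\overline{\{m_u\}_{0<u\le1}}$, where $\ell=\oint_{\hat\gamma}\mathrm{d}s$. Then there is a linear combination $f=\sum_{i=1}^na_if_i$ with real coefficients and $a_1\ne0$ such that $m_0$, $m_1$ and the momentum map $(f,f_2,\dots,f_n)$ satisfy the following periodicity condition: there exist a compact trajectory $\gamma_0$ of $X_f$ (a closed trajectory or an equilibrium) and a continuous one-parameter family of $2\pi$-periodic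 trajectories $\gamma_u\subset\mathcal O_{m_1}$, $0<u\le1$, of $X_f$ such that $m_1\in\gamma_1$ and $m_0\in\gamma_0\subset\overline{\bigcup_{0<u\le1}\gamma_u}$ (here $\mathcal O_{m_1}$ is the orbit for the functions $f,f_2,\dots,f_n$). -/

import Mathlib

open Set
open scoped Manifold ContDiff Topology

/-- The model space `ℝ²ⁿ` with its Euclidean norm. -/
abbrev R2 (n : ℕ) : Type := EuclideanSpace ℝ (Fin (2 * n))

section Symplectic

variable {n : ℕ} {M : Type*} [TopologicalSpace M] [ChartedSpace (R2 n) M]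

/-- The pullback `ψ^* ω` of a 2-form `ω` on `M` under a map `ψ : ℝ²ⁿ → M`. -/
noncomputable def pullbackForm
    (ω' : (m : M) → TangentSpace 𝓘(ℝ, R2 n) m [⋀^Fin 2]→L[ℝ] ℝ) (ψ : R2 n → M) (x : R2 n) :
    R2 n [⋀^Fin 2]→L[ℝ] ℝ :=
  (ω' (ψ x)).compContinuousLinearMap (mfderiv 𝓘(ℝ, R2 n) 𝓘(ℝ, R2 n) ψ x)

variable (n M) in
/-- A real-analytic symplectic form on the real-analytic manifold `M` of dimension `2n`:
a 2-form that is analytic and closed in every chart of the analytic structure, and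
nondegenerate at every point. -/
structure SymplecticForm where
  /-- the underlying 2-form -/
  form : (m : M) → TangentSpace 𝓘(ℝ, R2 n) m [⋀^Fin 2]→L[ℝ] ℝ
  analytic : ∀ e ∈ IsManifold.maximalAtlas 𝓘(ℝ, R2 n) ω M,
    ContDiffOn ℝ ω (pullbackForm form e.symm) e.target
  closed : ∀ e ∈ IsManifold.maximalAtlas 𝓘(ℝ, R2 n) ω M,
    ∀ x ∈ e.target, extDeriv (pullbackForm form e.symm) x = 0
  nondegenerate : ∀ (m : M) (v : TangentSpace 𝓘(ℝ, R2 n) m), (∀ w, form m ![w, v] = 0) → v = 0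

/-- The Hamiltonian vector field `X_f`, determined by `Ω(·, X_f) = df`. -/
noncomputable def hamVF (Ω : SymplecticForm n M) (f : M → ℝ) (m : M) :
    TangentSpace 𝓘(ℝ, R2 n) m :=
  Classical.epsilon fun X : TangentSpace 𝓘(ℝ, R2 n) m =>
    ∀ w : TangentSpace 𝓘(ℝ, R2 n) m, Ω.form m ![w, X] = mfderiv 𝓘(ℝ, R2 n) 𝓘(ℝ, ℝ) f m w

/-- `X_f` does satisfy its defining equation `Ω(·, X_f) = df`. -/
theorem hamVF_spec (Ω : SymplecticForm n M) (f : M → ℝ) (m : M)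
    (w : TangentSpace 𝓘(ℝ, R2 n) m) :
    Ω.form m ![w, hamVF Ω f m] = mfderiv 𝓘(ℝ, R2 n) 𝓘(ℝ, ℝ) f m w := by
  let A : R2 n [⋀^Fin 2]→L[ℝ] ℝ := Ω.form m
  have u0 : ∀ x y z : R2 n, Function.update ![x, y] 0 z = ![z, y] := by
    intro x y z; ext i : 1; fin_cases i <;> rfl
  have u1 : ∀ x y z : R2 n, Function.update ![x, y] 1 z = ![x, z] := by
    intro x y z; ext i : 1; fin_cases i <;> rfl
  let B : R2 n →ₗ[ℝ] Module.Dual ℝ (R2 n) := LinearMap.mk₂ ℝ (fun v w : R2 n => A ![w, v])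
    (fun v v' w => by simpa only [u1] using A.map_update_add ![w, v] 1 v v')
    (fun c v w => by simpa only [u1] using A.map_update_smul ![w, v] 1 c v)
    (fun v w w' => by simpa only [u0] using A.map_update_add ![w, v] 0 w w')
    (fun c v w => by simpa only [u0] using A.map_update_smul ![w, v] 0 c w)
  have hinj : Function.Injective B := by
    rw [← LinearMap.ker_eq_bot, LinearMap.ker_eq_bot']
    intro v hv
    exact Ω.nondegenerate m v fun w => LinearMap.congr_fun hv w
  have hsurj : Function.Surjective B :=
    (LinearMap.injective_iff_surjective_of_finrank_eq_finrank
      (Subspace.dual_finrank_eq (K := ℝ) (V := R2 n)).symm).1 hinj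
  obtain ⟨X, hX⟩ := hsurj (mfderiv 𝓘(ℝ, R2 n) 𝓘(ℝ, ℝ) f m).toLinearMap
  exact Classical.epsilon_spec (p := fun X : TangentSpace 𝓘(ℝ, R2 n) m =>
    ∀ w : TangentSpace 𝓘(ℝ, R2 n) m, Ω.form m ![w, X] = mfderiv 𝓘(ℝ, R2 n) 𝓘(ℝ, ℝ) f m w)
    ⟨X, fun w => LinearMap.congr_fun hX w⟩ w

/-- The `i`-th component `f_i` of the momentum map `F = (f_1, …, f_n)`. -/
def component (F : M → Fin n → ℝ) (i : Fin n) : M → ℝ := fun m => F m i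

/-- The rank of `dF` at `m`. -/
noncomputable def rankAt (F : M → Fin n → ℝ) (m : M) : ℕ :=
  Module.finrank ℝ
    (LinearMap.range (mfderiv 𝓘(ℝ, R2 n) 𝓘(ℝ, Fin n → ℝ) F m).toLinearMap)

/-- `Sing(F)`, the set of singular points of the momentum map. -/
def singSet (F : M → Fin n → ℝ) : Set M := {m | rankAt F m < n}

/-- `(M, Ω, F)` is a real-analytic integrable Hamiltonian system with `n` degrees of freedom:
the functions `f_i` are analytic, pairwise in involution (`{f_i, f_j} = Ω(X_{f_i}, X_{f_j})` up
to the sign convention), and functionally independent on a dense set. -/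
structure IsIntegrableSystem (Ω : SymplecticForm n M) (F : M → Fin n → ℝ) : Prop where
  analytic : ContMDiff 𝓘(ℝ, R2 n) 𝓘(ℝ, Fin n → ℝ) ω F
  involution : ∀ (i j : Fin n) (m : M),
    Ω.form m ![hamVF Ω (component F i) m, hamVF Ω (component F j) m] = 0
  independent : Dense (singSet F)ᶜ

/-- The regular part `L₀ \ Sing(F)` of the zero fibre `L₀ = F⁻¹(0)`. -/
def regFibre (F : M → Fin n → ℝ) : Set M := F ⁻¹' {0} \ singSet F

/-- The 1-form `θ_i` dual to the frame `X_{f_1}, …, X_{f_n}`: a linear form on `T_m M` with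
`θ_i(X_{f_j}) = δ_{ij}`. Its values on the tangent space of the fibre, which is spanned by
the `X_{f_j}` at a regular point `m`, are determined by this, and only these are used. -/
noncomputable def coframe (Ω : SymplecticForm n M) (F : M → Fin n → ℝ) (i : Fin n) (m : M) :
    TangentSpace 𝓘(ℝ, R2 n) m →ₗ[ℝ] ℝ :=
  Classical.epsilon fun θ : TangentSpace 𝓘(ℝ, R2 n) m →ₗ[ℝ] ℝ =>
    ∀ j : Fin n, θ (hamVF Ω (component F j) m) = if i = j then 1 else 0

/-- At a regular point of a differentiable momentum map the forms `θ_i` do form a dual basis. -/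
theorem coframe_spec (Ω : SymplecticForm n M) (F : M → Fin n → ℝ) (i : Fin n) (m : M)
    (hF : MDifferentiableAt 𝓘(ℝ, R2 n) 𝓘(ℝ, Fin n → ℝ) F m) (hm : m ∉ singSet F) (j : Fin n) :
    coframe Ω F i m (hamVF Ω (component F j) m) = if i = j then 1 else 0 := by
  let D : R2 n →L[ℝ] (Fin n → ℝ) := mfderiv 𝓘(ℝ, R2 n) 𝓘(ℝ, Fin n → ℝ) F m
  let A : R2 n [⋀^Fin 2]→L[ℝ] ℝ := Ω.form m
  let X : Fin n → R2 n := fun j => hamVF Ω (component F j) m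
  have hD : ∀ (j : Fin n) (w : R2 n), A ![w, X j] = D w j := by
    intro j w
    have h := hamVF_spec Ω (component F j) m w
    have hp : HasMFDerivAt 𝓘(ℝ, R2 n) 𝓘(ℝ, ℝ) (component F j) m
        ((ContinuousLinearMap.proj (R := ℝ) (φ := fun _ : Fin n => ℝ) j).comp D) :=
      (ContinuousLinearMap.hasMFDerivAt
        (ContinuousLinearMap.proj (R := ℝ) (φ := fun _ : Fin n => ℝ) j)).comp m hF.hasMFDerivAt
    rw [hp.mfderiv] at h
    exact h
  have hsurj : Function.Surjective D := by
    have h1 : ¬ Module.finrank ℝ (LinearMap.range D.toLinearMap) < n := hm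
    have h2 := Submodule.finrank_le (LinearMap.range D.toLinearMap)
    rw [Module.finrank_fin_fun] at h2
    have h3 : LinearMap.range D.toLinearMap = ⊤ := by
      apply Submodule.eq_top_of_finrank_eq
      rw [Module.finrank_fin_fun]
      omega
    exact LinearMap.range_eq_top.1 h3
  have hind : LinearIndependent ℝ X := by
    rw [Fintype.linearIndependent_iff]
    intro g hg k
    obtain ⟨w, hw⟩ := hsurj (Pi.single k 1)
    have u1 : ∀ x y z : R2 n, Function.update ![x, y] 1 z = ![x, z] := by
      intro x y z; ext i : 1; fin_cases i <;> rfl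
    let L : R2 n →ₗ[ℝ] ℝ :=
      { toFun := fun v => A ![w, v]
        map_add' := fun v v' => by simpa only [u1] using A.map_update_add ![w, v] 1 v v'
        map_smul' := fun c v => by simpa only [u1, RingHom.id_apply] using A.map_update_smul ![w, v] 1 c v }
    have h := congrArg L hg
    rw [map_sum, map_zero] at h
    have h' : ∀ j, L (g j • X j) = g j * (Pi.single k (1 : ℝ) : Fin n → ℝ) j := by
      intro j
      rw [map_smul, smul_eq_mul, ← hw]
      exact congrArg (g j * ·) (hD j w)
    simpa [h', Pi.single_apply] using h
  obtain ⟨P, hP⟩ := (Fintype.linearCombination ℝ X).exists_leftInverse_of_injective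
    (LinearMap.ker_eq_bot.2 hind.fintypeLinearCombination_injective)
  refine Classical.epsilon_spec (p := fun θ : TangentSpace 𝓘(ℝ, R2 n) m →ₗ[ℝ] ℝ =>
    ∀ j : Fin n, θ (hamVF Ω (component F j) m) = if i = j then 1 else 0)
    ⟨(LinearMap.proj (R := ℝ) (φ := fun _ : Fin n => ℝ) i).comp P, fun j => ?_⟩ j
  have h := LinearMap.congr_fun hP (Pi.single j 1)
  rw [LinearMap.comp_apply, Fintype.linearCombination_apply_single, one_smul] at h
  change P (X j) i = _
  rw [h]
  simp [Pi.single_apply]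

/-- The velocity vector of a curve. -/
noncomputable def velocity (γ : ℝ → M) (t : ℝ) : TangentSpace 𝓘(ℝ, R2 n) (γ t) :=
  mfderiv 𝓘(ℝ, ℝ) 𝓘(ℝ, R2 n) γ t (1 : ℝ)

/-- A piecewise continuously differentiable closed curve, parametrized by `[0, 1]`. -/
structure IsPiecewiseC1Loop (γ : ℝ → M) : Prop where
  closed : γ 0 = γ 1
  piecewise_C1 : ∃ (N : ℕ) (τ : ℕ → ℝ), Monotone τ ∧ τ 0 = 0 ∧ τ N = 1 ∧
    ∀ k < N, ContMDiffOn 𝓘(ℝ, ℝ) 𝓘(ℝ, R2 n) 1 γ (Icc (τ k) (τ (k + 1)))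

/-- The integral `∮_γ θ_i`. -/
noncomputable def loopIntegral (Ω : SymplecticForm n M) (F : M → Fin n → ℝ) (i : Fin n)
    (γ : ℝ → M) : ℝ :=
  ∫ t in (0 : ℝ)..1, coframe Ω F i (γ t) (velocity γ t)

/-- The length `∮_γ ds` for the flat metric `ds² = ∑ θ_i²` on the regular part of the fibre. -/
noncomputable def loopLength (Ω : SymplecticForm n M) (F : M → Fin n → ℝ) (γ : ℝ → M) : ℝ :=
  ∫ t in (0 : ℝ)..1, Real.sqrt (∑ i, (coframe Ω F i (γ t) (velocity γ t)) ^ 2)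

/-- The orbit `O_m` of `m` under the local Hamiltonian `ℝⁿ`-action generated by `f_1, …, f_n`:
all points reachable from `m` by following finitely many (not necessarily complete)
trajectories of the fields `X_{f_i}`, forwards or backwards. -/
def hamOrbit (Ω : SymplecticForm n M) (F : M → Fin n → ℝ) (m : M) : Set M :=
  {m' | Relation.ReflTransGen (fun p q : M => ∃ (i : Fin n) (γ : ℝ → M) (T : ℝ),
    IsMIntegralCurveOn (I := 𝓘(ℝ, R2 n)) γ (hamVF Ω (component F i)) (uIcc 0 T) ∧
      γ 0 = p ∧ γ T = q) m m'}

/-- The flows of all `X_{f_i}` are complete in the zero fibre `L₀ = F⁻¹(0)`. -/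
def FlowsCompleteInZeroFibre (Ω : SymplecticForm n M) (F : M → Fin n → ℝ) : Prop :=
  ∀ (i : Fin n), ∀ p ∈ F ⁻¹' {0}, ∃ γ : ℝ → M,
    IsMIntegralCurve (I := 𝓘(ℝ, R2 n)) γ (hamVF Ω (component F i)) ∧ γ 0 = p

/-- The standard symplectic form `∑ dx_{2i-1} ∧ dx_{2i}` on `ℝ²ⁿ` (coordinates are numbered
from `0` here). -/
def stdSymplectic (x y : R2 n) : ℝ :=
  ∑ i : Fin n,
    (x ⟨2 * i, by omega⟩ * y ⟨2 * i + 1, by omega⟩ - x ⟨2 * i + 1, by omega⟩ * y ⟨2 * i, by omega⟩)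

/-- `φ` is a canonical coordinate chart centred at `m₀` whose image is the open ball of
radius `r` about the origin. -/
structure IsCanonicalChart (Ω : SymplecticForm n M) (m₀ : M) (r : ℝ)
    (φ : OpenPartialHomeomorph M (R2 n)) : Prop where
  smooth : φ ∈ IsManifold.maximalAtlas 𝓘(ℝ, R2 n) ∞ M
  mem_source : m₀ ∈ φ.source
  centred : φ m₀ = 0
  target_eq : φ.target = Metric.ball 0 r
  canonical : ∀ m ∈ φ.source, ∀ v w : TangentSpace 𝓘(ℝ, R2 n) m,
    Ω.form m ![v, w] = stdSymplectic
      (mfderiv 𝓘(ℝ, R2 n) 𝓘(ℝ, R2 n) φ m v) (mfderiv 𝓘(ℝ, R2 n) 𝓘(ℝ, R2 n) φ m w)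

/-- The periodicity condition for the points `m₀, m₁` and the momentum map `F`: there are a
compact trajectory `γ₀` (closed or an equilibrium) of `X_{f_1}` and a continuous family
`γ_u ⊂ O_{m₁}`, `0 < u ≤ 1`, of `2π`-periodic trajectories of `X_{f_1}` with `m₁ ∈ γ_1` and
`m₀ ∈ γ₀ ⊂ closure (⋃ γ_u)`. -/
def PeriodicityCondition [NeZero n] (Ω : SymplecticForm n M) (F : M → Fin n → ℝ)
    (m₀ m₁ : M) : Prop :=
  ∃ (γ₀ : ℝ → M) (Γ : ℝ → ℝ → M),
    IsMIntegralCurve (I := 𝓘(ℝ, R2 n)) γ₀ (hamVF Ω (component F 0)) ∧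
    (∃ T > 0, Function.Periodic γ₀ T) ∧
    ContinuousOn (fun p : ℝ × ℝ => Γ p.1 p.2) (Ioc 0 1 ×ˢ univ) ∧
    (∀ u ∈ Ioc (0 : ℝ) 1,
      IsMIntegralCurve (I := 𝓘(ℝ, R2 n)) (Γ u) (hamVF Ω (component F 0)) ∧
      Function.Periodic (Γ u) (2 * Real.pi) ∧
      range (Γ u) ⊆ hamOrbit Ω F m₁) ∧
    m₁ ∈ range (Γ 1) ∧
    m₀ ∈ range γ₀ ∧
    range γ₀ ⊆ closure (⋃ u ∈ Ioc (0 : ℝ) 1, range (Γ u))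

/-- The momentum map `(f, f_2, …, f_n)` with `f = ∑ a_i f_i`. -/
def replaceFirst [NeZero n] (F : M → Fin n → ℝ) (a : Fin n → ℝ) : M → Fin n → ℝ :=
  fun m => Function.update (F m) 0 (∑ i, a i * F m i)

end Symplectic

/-! ### Time-one maps of commuting vector fields on a normed space. -/

section FlowOfCommutingFields

variable {E V : Type*} [NormedAddCommGroup E] [NormedSpace ℝ E] [NormedAddCommGroup V]
  [NormedSpace ℝ V]

/-! The proof studies flat maps: maps `Φ` from part of `ℝⁿ` to `M` whose derivative at `s` sends `v`
to `∑ vᵢ X_{fᵢ}(Φ s)`. They are the orbit maps of the local `ℝⁿ`-action. Since the Hamiltonian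
fields commute, the time-one map of `∑ sᵢ X_{fᵢ}`, as a function of `s`, is flat wherever it is
defined (`hasFDerivAt_timeOne_of_commuting`, `hamiltonian_commute`). Flat maps are rigid: on a
convex set they are determined by one value, by ODE uniqueness along segments (`IsFlat.eqOn`). Near
a regular point a flat map parametrizes the fibre (`exists_flat_chart`), and the `θᵢ` become the
coordinate differentials of the parameter space.

Hence a curve in the regular fibre lifts through a flat map to the integral of its `θ`-speed. Let `w
= (∮θ₁, …, ∮θₙ)`. If a flat map starts at a point of the loop and is defined on a ball of radius
larger than the length `ℓ`, the whole loop lifts, and `w` is a period: `Φ w = Φ 0`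
(`IsPiecewiseC1Loop.flat_period`).

Now let the base point move along a path in the regular fibre, with flat maps on balls of radius
larger than `‖w‖`. Nearby flat maps are translates of each other, so having `w` as a period is an
open and closed condition along the path (`flat_period_of_path`). With `a = w / 2π`, the field `X_f
= ∑ aᵢ X_{fᵢ}` has a `2π`-periodic trajectory through every point of the path, and `a₁ ≠ 0` because
`∮θ₁ ≠ 0`. The path accumulates at `m₀`, an equilibrium because `dF(m₀) = 0`, so the constant
trajectory at `m₀` serves as `γ₀` (`periodicityCondition_of_path`).

It remains to find the path and the large flat maps. If the flows are complete, the flat map at `m₁`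
extends to all of `ℝⁿ`, its image contains the orbit, and a curve with dense image in `ℝⁿ` gives the
path. In the canonical chart the path is given; the bound on the differentials makes the fields grow
at most linearly, and Gronwall's inequality keeps a trajectory starting within `r e^{-ncℓ}` of the
origin inside the ball for parameters of size slightly above `ℓ`. -/

theorem gronwallBound_zero_mul (K ε b x : ℝ) :
    gronwallBound 0 K (ε * b) x = gronwallBound 0 K ε x * b := by
  unfold gronwallBound
  split_ifs <;> ring

/-- The time-one map of a linear family `A(·)v` of commuting vector fields, as a function of the
parameter `v`, is differentiable and its derivative at `s` is `A` at the endpoint. -/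
theorem hasFDerivAt_timeOne_of_commuting {A : E → V →L[ℝ] E} {A' : E → E →L[ℝ] V →L[ℝ] E}
    {W : Set E} (hW : Convex ℝ W) {C₀ K₁ K₂ : ℝ} (hK₁ : 0 ≤ K₁) (hK₂ : 0 ≤ K₂)
    (hA : ∀ x ∈ W, HasFDerivAt A (A' x) x) (hC₀ : ∀ x ∈ W, ‖A x‖ ≤ C₀)
    (hA₁ : ∀ x ∈ W, ‖A' x‖ ≤ K₁) (hA₂ : ∀ x ∈ W, ∀ y ∈ W, ‖A' y - A' x‖ ≤ K₂ * ‖y - x‖)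
    (hcomm : ∀ x ∈ W, ∀ v w, A' x (A x v) w = A' x (A x w) v)
    {Z : Set V} (hZ : IsOpen Z) {u : V → ℝ → E} {x₀ : E} (hu₀ : ∀ s ∈ Z, u s 0 = x₀)
    (hu : ∀ s ∈ Z, ∀ t ∈ Icc (0 : ℝ) 1, HasDerivWithinAt (u s) (A (u s t) s) (Icc 0 1) t)
    (huW : ∀ s ∈ Z, ∀ t ∈ Icc (0 : ℝ) 1, u s t ∈ W) {s : V} (hs : s ∈ Z) :
    HasFDerivAt (fun s => u s 1) (A (u s 1)) s := by
  have hlip : ∀ x ∈ W, ∀ y ∈ W, ‖A y - A x‖ ≤ K₁ * ‖y - x‖ := fun x hx y hy =>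
    hW.norm_image_sub_le_of_norm_hasFDerivWithin_le
      (fun z hz => (hA z hz).hasFDerivWithinAt) hA₁ hx hy
  have htay : ∀ x ∈ W, ∀ y ∈ W, ‖A y - A x - A' x (y - x)‖ ≤ K₂ * ‖y - x‖ * ‖y - x‖ := by
    intro x hx y hy
    have hseg : segment ℝ x y ⊆ W := hW.segment_subset hx hy
    refine (convex_segment x y).norm_image_sub_le_of_norm_hasFDerivWithin_le'
      (fun z hz => (hA z (hseg hz)).hasFDerivWithinAt) (fun z hz => ?_)
      (left_mem_segment ℝ x y) (right_mem_segment ℝ x y)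
    refine (hA₂ x hx z (hseg hz)).trans (mul_le_mul_of_nonneg_left ?_ hK₂)
    obtain ⟨a, b, ha, hb, hab, rfl⟩ := hz
    have : a • x + b • y - x = b • (y - x) := by
      rw [← eq_sub_iff_add_eq] at hab
      subst hab
      module
    rw [this, norm_smul, Real.norm_of_nonneg hb]
    exact mul_le_of_le_one_left (norm_nonneg _) (by linarith)
  have hright : ∀ {f : ℝ → E} {f' : E} {t : ℝ}, t ∈ Ico (0 : ℝ) 1 →
      HasDerivWithinAt f f' (Icc 0 1) t → HasDerivWithinAt f f' (Ici t) t := fun ht h =>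
    h.mono_of_mem_nhdsWithin
      (Filter.mem_of_superset (Icc_mem_nhdsGE ht.2) (Icc_subset_Icc_left ht.1))
  -- A Lipschitz constant of the single field `A(·)s` on `W`.
  set K := K₁ * ‖s‖ with hK
  have hK0 : 0 ≤ K := by positivity
  set C₁ := gronwallBound 0 K C₀ 1 with hC₁
  have hdist : ∀ v, s + v ∈ Z → ∀ t ∈ Icc (0 : ℝ) 1, ‖u (s + v) t - u s t‖ ≤ C₁ * ‖v‖ := by
    intro v hv t ht
    have h1 : ∀ t ∈ Icc (0 : ℝ) 1, HasDerivWithinAt (fun t => u (s + v) t - u s t)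
        (A (u (s + v) t) (s + v) - A (u s t) s) (Icc 0 1) t := fun t ht =>
      (hu _ hv t ht).sub (hu _ hs t ht)
    have hC₀' : 0 ≤ C₀ := (norm_nonneg _).trans (hC₀ _ (huW _ hs _ ht))
    have h2 := norm_le_gronwallBound_of_norm_deriv_right_le (δ := 0) (K := K) (ε := C₀ * ‖v‖)
      (fun t ht => (h1 t ht).continuousWithinAt) (fun t ht => hright ht (h1 t ⟨ht.1, ht.2.le⟩))
      (by simp [hu₀ _ hs, hu₀ _ hv]) (fun t ht => ?_) t ht
    · rw [sub_zero] at h2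
      refine h2.trans ?_
      rw [← gronwallBound_zero_mul]
      exact gronwallBound_mono le_rfl (by positivity) hK0 ht.2
    · have ht' : t ∈ Icc (0 : ℝ) 1 := ⟨ht.1, ht.2.le⟩
      have : A (u (s + v) t) (s + v) - A (u s t) s
          = (A (u (s + v) t) - A (u s t)) s + A (u (s + v) t) v := by
        simp only [map_add, sub_apply]; abel
      rw [this]
      refine (norm_add_le _ _).trans (add_le_add ?_ ?_)
      · refine (ContinuousLinearMap.le_opNorm _ _).trans ?_
        calc _ ≤ (K₁ * ‖u (s + v) t - u s t‖) * ‖s‖ := by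
              gcongr; exact hlip _ (huW _ hs _ ht') _ (huW _ hv _ ht')
          _ = _ := by rw [hK]; ring
      · refine (ContinuousLinearMap.le_opNorm _ _).trans ?_
        gcongr; exact hC₀ _ (huW _ hv _ ht')
  set C₃ := K₂ * C₁ * C₁ * ‖s‖ + K₁ * C₁ with hC₃
  -- Because the fields commute, `t • A (u s t) v` solves the variational equation along `u s`. Its
  -- difference from the displacement `u (s + v) t - u s t` therefore satisfies a linear inequality
  -- with a source of order `‖v‖²`, and Gronwall applies.
  have hfin : ∀ v, s + v ∈ Z →
      ‖u (s + v) 1 - u s 1 - A (u s 1) v‖ ≤ gronwallBound 0 K C₃ 1 * ‖v‖ ^ 2 := by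
    intro v hv
    have hsub : ∀ t ∈ Icc (0 : ℝ) 1, HasDerivWithinAt
        (fun t => u (s + v) t - u s t - t • A (u s t) v)
        (A (u (s + v) t) (s + v) - A (u s t) s -
          (t • A' (u s t) (A (u s t) s) v + (1 : ℝ) • A (u s t) v)) (Icc 0 1) t := by
      intro t ht
      refine ((hu _ hv t ht).sub (hu _ hs t ht)).sub ((hasDerivWithinAt_id t _).smul ?_)
      have h := (hA _ (huW _ hs _ ht)).comp_hasDerivWithinAt t (hu _ hs t ht)
      exact ((ContinuousLinearMap.apply ℝ E v).hasFDerivAt).comp_hasDerivWithinAt t h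
    have h2 := norm_le_gronwallBound_of_norm_deriv_right_le (δ := 0) (K := K) (ε := C₃ * ‖v‖ ^ 2)
      (fun t ht => (hsub t ht).continuousWithinAt) (fun t ht => hright ht (hsub t ⟨ht.1, ht.2.le⟩))
      (by simp [hu₀ _ hs, hu₀ _ hv]) (fun t ht => ?_) 1 ⟨zero_le_one, le_rfl⟩
    · rw [sub_zero, gronwallBound_zero_mul] at h2
      simpa using h2
    · have ht' : t ∈ Icc (0 : ℝ) 1 := ⟨ht.1, ht.2.le⟩
      have hs' := huW _ hs _ ht'
      have hv' := huW _ hv _ ht'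
      have hd := hdist v hv t ht'
      have hCv : 0 ≤ C₁ * ‖v‖ := (norm_nonneg _).trans hd
      set d := u (s + v) t - u s t with hd_def
      have : A (u (s + v) t) (s + v) - A (u s t) s -
          (t • A' (u s t) (A (u s t) s) v + (1 : ℝ) • A (u s t) v)
          = (A (u (s + v) t) - A (u s t) - A' (u s t) d) s
            + A' (u s t) (d - t • A (u s t) v) s + (A (u (s + v) t) - A (u s t)) v := by
        -- The only use of commutativity: the derivative of `A(·)v` along the trajectory becomes the
        -- linearization of `A(·)s` in the direction `A(·)v`.
        rw [hcomm _ hs' s v]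
        simp only [map_add, map_sub, map_smul, sub_apply,
          smul_apply, one_smul]
        abel
      rw [this]
      have e1 : ‖(A (u (s + v) t) - A (u s t) - A' (u s t) d) s‖
          ≤ K₂ * (C₁ * ‖v‖) * (C₁ * ‖v‖) * ‖s‖ := by
        refine (ContinuousLinearMap.le_opNorm _ _).trans ?_
        have := htay _ hs' _ hv'
        rw [← hd_def] at this
        gcongr
        refine this.trans ?_
        gcongr
      have e2 : ‖A' (u s t) (d - t • A (u s t) v) s‖ ≤ K * ‖d - t • A (u s t) v‖ := by
        refine (ContinuousLinearMap.le_opNorm₂ _ _ _).trans ?_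
        rw [hK]
        calc _ ≤ K₁ * ‖d - t • A (u s t) v‖ * ‖s‖ := by gcongr; exact hA₁ _ hs'
          _ = _ := by ring
      have e3 : ‖(A (u (s + v) t) - A (u s t)) v‖ ≤ K₁ * (C₁ * ‖v‖) * ‖v‖ := by
        refine (ContinuousLinearMap.le_opNorm _ _).trans ?_
        gcongr
        exact (hlip _ hs' _ hv').trans (by gcongr)
      calc _ ≤ _ := (norm_add_le _ _).trans (add_le_add (norm_add_le _ _) le_rfl)
        _ ≤ _ := add_le_add (add_le_add e1 e2) e3
        _ = _ := by rw [hC₃]; ring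
  rw [hasFDerivAt_iff_isLittleO_nhds_zero]
  have hO : (fun v => u (s + v) 1 - u s 1 - A (u s 1) v) =O[𝓝 0] fun v => ‖v‖ ^ 2 := by
    refine Asymptotics.IsBigO.of_bound (gronwallBound 0 K C₃ 1) ?_
    have : Filter.Tendsto (fun v => s + v) (𝓝 (0 : V)) (𝓝 (s + 0)) := by
      exact (continuous_const.add continuous_id).tendsto 0
    rw [add_zero] at this
    filter_upwards [this (hZ.mem_nhds hs)] with v hv
    simpa using hfin v hv
  refine hO.trans_isLittleO ?_
  exact Asymptotics.isLittleO_norm_pow_id one_lt_two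

/-- Solutions on `[0, 1]` of a bounded, globally Lipschitz autonomous equation. -/
theorem exists_hasDerivWithinAt_of_lipschitz_of_bounded [CompleteSpace E] {Y : E → E}
    {K L : NNReal} (hK : LipschitzWith K Y) (hL : ∀ x, ‖Y x‖ ≤ L) (x₀ : E) :
    ∃ y : ℝ → E, y 0 = x₀ ∧ ∀ t ∈ Icc (0 : ℝ) 1, HasDerivWithinAt y (Y (y t)) (Icc 0 1) t := by
  have h : IsPicardLindelof (fun _ => Y) (⟨0, by simp⟩ : Icc (0 : ℝ) 1) x₀ L 0 L K :=
    { lipschitzOnWith := fun _ _ => hK.lipschitzOnWith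
      continuousOn := fun _ _ => continuousOn_const
      norm_le := fun _ _ x _ => hL x
      mul_max_le := by simp }
  exact h.exists_eq_forall_mem_Icc_hasDerivWithinAt₀

/-- For growth of the form `‖y'‖ ≤ K(a + ‖y‖)` the shifted quantity `a + ‖y‖` grows at most
exponentially; in this form the case `K = 0` needs no separate treatment. -/
theorem gronwallBound_mul_right (δ K a x : ℝ) :
    gronwallBound δ K (K * a) x = (a + δ) * Real.exp (K * x) - a := by
  by_cases hK : K = 0
  · simp [hK, gronwallBound_K0]
  · rw [gronwallBound_of_K_ne_0 hK]
    field_simp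
    ring

/-- If the commuting fields `A(·)v` grow at most linearly on a ball, then their time-one map
starting at `x₀` is defined for all small parameters, with an explicit bound on their size. -/
theorem exists_timeOne_of_commuting [FiniteDimensional ℝ E] {A : E → V →L[ℝ] E} {c x₀ : E}
    {R κ α ρ : ℝ} (hκ : 0 ≤ κ) (hα : 0 ≤ α) (hA : ContDiffOn ℝ 2 A (Metric.ball c R))
    (hcomm : ∀ x ∈ Metric.ball c R, ∀ v w, fderiv ℝ A x (A x v) w = fderiv ℝ A x (A x w) v)
    (hbd : ∀ x ∈ Metric.ball c R, ‖A x‖ ≤ κ * (α + ‖x - c‖)) (hρ : 0 < ρ)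
    (hR : (α + ‖x₀ - c‖) * Real.exp (κ * ρ) < α + R) :
    ∃ Ψ : V → E, Ψ 0 = x₀ ∧ ∀ s ∈ Metric.ball (0 : V) ρ,
      Ψ s ∈ Metric.ball c R ∧ HasFDerivAt Ψ (A (Ψ s)) s := by
  -- `R₁` lies strictly between the a priori bound on the solutions and `R`, leaving room for a
  -- cutoff.
  obtain ⟨R₁, hR₁, hR₁R⟩ : ∃ R₁, (α + ‖x₀ - c‖) * Real.exp (κ * ρ) - α < R₁ ∧ R₁ < R :=
    exists_between (by linarith)
  have hexp : 1 ≤ Real.exp (κ * ρ) := Real.one_le_exp (by positivity)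
  have hx₀R₁ : ‖x₀ - c‖ < R₁ := by nlinarith [norm_nonneg (x₀ - c)]
  have hR₁0 : 0 < R₁ := (norm_nonneg _).trans_lt hx₀R₁
  -- The cutoff makes every field globally Lipschitz and bounded, so solutions exist on `[0, 1]`.
  -- For `‖s‖ < ρ` they stay where the cutoff equals one, hence solve the original equation.
  let f : ContDiffBump c := ⟨R₁, (R₁ + R) / 2, hR₁0, by linarith⟩
  have hf2 : tsupport f ⊆ Metric.ball c R := by
    rw [f.tsupport_eq]
    exact Metric.closedBall_subset_ball (show (R₁ + R) / 2 < R by linarith)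
  have hWb : Metric.closedBall c R₁ ⊆ Metric.ball c R := Metric.closedBall_subset_ball hR₁R
  have hsol : ∀ s : V, ∃ y : ℝ → E, y 0 = x₀ ∧
      ∀ t ∈ Icc (0 : ℝ) 1, HasDerivWithinAt y (f (y t) • A (y t) s) (Icc 0 1) t := by
    intro s
    have hY : ContDiff ℝ 1 fun x => f x • A x s := by
      refine contDiff_iff_contDiffAt.2 fun x => ?_
      by_cases hx : x ∈ tsupport f
      swap
      · refine (contDiffAt_const (c := (0 : E))).congr_of_eventuallyEq ?_
        filter_upwards [notMem_tsupport_iff_eventuallyEq.1 hx] with y hy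
        simp [hy]
      have hx' : x ∈ Metric.ball c R := hf2 hx
      have h1 : ContDiffAt ℝ 1 A x :=
        (hA.contDiffAt (Metric.isOpen_ball.mem_nhds hx')).of_le (by norm_num)
      exact f.contDiffAt.smul (h1.clm_apply contDiffAt_const)
    have hc : HasCompactSupport fun x => f x • A x s := f.hasCompactSupport.smul_right
    obtain ⟨K, hK⟩ := hY.lipschitzWith_of_hasCompactSupport hc (by norm_num)
    obtain ⟨L, hL⟩ := hc.exists_bound_of_continuous hY.continuous
    exact exists_hasDerivWithinAt_of_lipschitz_of_bounded (L := L.toNNReal) hK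
      (fun x => (hL x).trans (Real.le_coe_toNNReal L)) x₀
  choose u hu₀ hu using hsol
  have huW : ∀ s ∈ Metric.ball (0 : V) ρ, ∀ t ∈ Icc (0 : ℝ) 1, u s t ∈ Metric.closedBall c R₁ := by
    intro s hs t ht
    rw [mem_ball_zero_iff] at hs
    have h := norm_le_gronwallBound_of_norm_deriv_right_le (f := fun t => u s t - c)
      (δ := ‖x₀ - c‖) (K := κ * ‖s‖) (ε := κ * ‖s‖ * α)
      (fun t ht => ((hu s t ht).sub_const c).continuousWithinAt)
      (fun t ht => ((hu s t ⟨ht.1, ht.2.le⟩).sub_const c).mono_of_mem_nhdsWithin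
        (Filter.mem_of_superset (Icc_mem_nhdsGE ht.2) (Icc_subset_Icc_left ht.1)))
      (by simp [hu₀]) (fun t _ => ?_) t ht
    · rw [gronwallBound_mul_right, sub_zero] at h
      rw [mem_closedBall_iff_norm]
      refine h.trans (le_trans (sub_le_sub_right ?_ _) hR₁.le)
      have : κ * ‖s‖ * t ≤ κ * ρ := by
        calc κ * ‖s‖ * t ≤ κ * ‖s‖ * 1 := mul_le_mul_of_nonneg_left ht.2 (by positivity)
          _ ≤ κ * ρ := by rw [mul_one]; gcongr
      gcongr
    · by_cases hb : u s t ∈ Metric.ball c R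
      · calc ‖f (u s t) • A (u s t) s‖ ≤ 1 * (κ * (α + ‖u s t - c‖) * ‖s‖) := by
              rw [norm_smul, Real.norm_of_nonneg f.nonneg]
              gcongr
              · exact f.le_one
              · exact ((A (u s t)).le_opNorm s).trans (by gcongr; exact hbd _ hb)
          _ = _ := by ring
      · have : f (u s t) = 0 := image_eq_zero_of_notMem_tsupport fun h => hb (hf2 h)
        rw [this, zero_smul, norm_zero]
        positivity
  have hu' : ∀ s ∈ Metric.ball (0 : V) ρ, ∀ t ∈ Icc (0 : ℝ) 1,
      HasDerivWithinAt (u s) (A (u s t) s) (Icc 0 1) t := by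
    intro s hs t ht
    have h := hu s t ht
    rwa [f.one_of_mem_closedBall (huW s hs t ht), one_smul] at h
  have hK : IsCompact (Metric.closedBall c R₁) :=
    haveI := FiniteDimensional.proper ℝ E
    isCompact_closedBall c R₁
  have hA1 : ContDiffOn ℝ 1 (fderiv ℝ A) (Metric.ball c R) :=
    hA.fderiv_of_isOpen Metric.isOpen_ball (by norm_num)
  obtain ⟨C₀, hC₀⟩ := hK.exists_bound_of_continuousOn (hA.continuousOn.mono hWb)
  obtain ⟨K₁, hK₁⟩ : ∃ C, ∀ x ∈ Metric.closedBall c R₁, ‖fderiv ℝ A x‖ ≤ C :=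
    hK.exists_bound_of_continuousOn (E := E →L[ℝ] V →L[ℝ] E) (hA1.continuousOn.mono hWb)
  obtain ⟨K₂, hK₂⟩ := (hA1.mono hWb).exists_lipschitzOnWith one_ne_zero
    (convex_closedBall c R₁) hK
  have hcW : c ∈ Metric.closedBall c R₁ := Metric.mem_closedBall_self hR₁0.le
  refine ⟨fun s => u s 1, ?_, fun s hs => ⟨hWb (huW s hs 1 ⟨zero_le_one, le_rfl⟩), ?_⟩⟩
  · have h := hu' 0 (Metric.mem_ball_self hρ)
    simp only [map_zero] at h
    have := (convex_Icc (0 : ℝ) 1).norm_image_sub_le_of_norm_hasDerivWithin_le h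
      (C := 0) (by simp) (left_mem_Icc.2 zero_le_one) (right_mem_Icc.2 zero_le_one)
    rw [hu₀] at this
    simpa [sub_eq_zero] using this
  · exact hasFDerivAt_timeOne_of_commuting (convex_closedBall c R₁)
      ((norm_nonneg (fderiv ℝ A c)).trans (hK₁ c hcW)) K₂.coe_nonneg
      (fun x hx => ((hA.differentiableOn (by norm_num)).differentiableAt
        (Metric.isOpen_ball.mem_nhds (hWb hx))).hasFDerivAt)
      hC₀ hK₁ (fun x hx y hy => hK₂.norm_sub_le hy hx)
      (fun x hx => hcomm x (hWb hx)) Metric.isOpen_ball (fun s _ => hu₀ s) hu' huW hs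

end FlowOfCommutingFields

/-! ### Smoothness and commutation of Hamiltonian fields in coordinates. -/

section HamiltonianFields

variable {E V : Type*} [NormedAddCommGroup E] [NormedSpace ℝ E] [FiniteDimensional ℝ E]
  [NormedAddCommGroup V] [NormedSpace ℝ V] [FiniteDimensional ℝ V]

/-- The arguments are reversed so that `B X` is the functional `Ω(·, X)` of the equation defining a
Hamiltonian field. -/
theorem exists_bilinear_of_form (η : E [⋀^Fin 2]→L[ℝ] ℝ) :
    ∃ B : E →L[ℝ] E →L[ℝ] ℝ, ∀ v w, B v w = η ![w, v] := by
  have u0 : ∀ x y z : E, Function.update ![x, y] 0 z = ![z, y] := by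
    intro x y z; ext i : 1; fin_cases i <;> rfl
  have u1 : ∀ x y z : E, Function.update ![x, y] 1 z = ![x, z] := by
    intro x y z; ext i : 1; fin_cases i <;> rfl
  let B : E →ₗ[ℝ] Module.Dual ℝ E := LinearMap.mk₂ ℝ (fun v w : E => η ![w, v])
    (fun v v' w => by simpa only [u1] using η.map_update_add ![w, v] 1 v v')
    (fun c v w => by simpa only [u1] using η.map_update_smul ![w, v] 1 c v)
    (fun v w w' => by simpa only [u0] using η.map_update_add ![w, v] 0 w w')
    (fun c v w => by simpa only [u0] using η.map_update_smul ![w, v] 0 c w)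
  exact ⟨LinearMap.toContinuousLinearMap
    ((LinearMap.toContinuousLinearMap : (E →ₗ[ℝ] ℝ) ≃ₗ[ℝ] (E →L[ℝ] ℝ)).toLinearMap ∘ₗ B),
    fun v w => rfl⟩

/-- The bilinear map `(v, w) ↦ η(w, v)`. -/
noncomputable def formBilin (η : E [⋀^Fin 2]→L[ℝ] ℝ) : E →L[ℝ] E →L[ℝ] ℝ :=
  (exists_bilinear_of_form η).choose

theorem formBilin_apply (η : E [⋀^Fin 2]→L[ℝ] ℝ) (v w : E) : formBilin η v w = η ![w, v] :=
  (exists_bilinear_of_form η).choose_spec v w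

omit [FiniteDimensional ℝ E] in
theorem form_swap (η : E [⋀^Fin 2]→L[ℝ] ℝ) (v w : E) : η ![v, w] = - η ![w, v] := by
  have h := η.map_swap ![w, v] (i := 0) (j := 1) (by decide)
  have h2 : ![w, v] ∘ Equiv.swap 0 1 = ![v, w] := by
    ext i : 1
    fin_cases i <;> simp
  rw [h2] at h
  exact h

theorem form_sum_right {ι : Type*} [Fintype ι] (η : E [⋀^Fin 2]→L[ℝ] ℝ) (w : E) (v : ι → ℝ)
    (u : ι → E) : η ![w, ∑ i, v i • u i] = ∑ i, v i * η ![w, u i] := by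
  simp only [← formBilin_apply, map_sum, map_smul, sum_apply, smul_apply, smul_eq_mul]

theorem contDiffOn_formBilin {ω' : E → E [⋀^Fin 2]→L[ℝ] ℝ} {W : Set E} {k : WithTop ℕ∞}
    (h : ContDiffOn ℝ k ω' W) : ContDiffOn ℝ k (fun x => formBilin (ω' x)) W := by
  refine contDiffOn_clm_apply.2 fun v => contDiffOn_clm_apply.2 fun w => ?_
  simp only [formBilin_apply]
  exact (ContinuousAlternatingMap.apply ℝ E ℝ ![w, v]).contDiff.comp_contDiffOn h

/-- Nondegeneracy is injectivity, and `E` and its dual have equal dimension. Invertibility is what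
lets the Hamiltonian equation be solved smoothly and uniquely. -/
theorem exists_equiv_formBilin {η : E [⋀^Fin 2]→L[ℝ] ℝ}
    (h : ∀ v, (∀ w, η ![w, v] = 0) → v = 0) :
    ∃ e : E ≃L[ℝ] (E →L[ℝ] ℝ), (e : E →L[ℝ] (E →L[ℝ] ℝ)) = formBilin η := by
  have hinj : Function.Injective (formBilin η).toLinearMap := by
    rw [← LinearMap.ker_eq_bot, LinearMap.ker_eq_bot']
    intro v hv
    refine h v fun w => ?_
    rw [← formBilin_apply]
    exact congrArg (fun L : E →L[ℝ] ℝ => L w) hv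
  have hfr : Module.finrank ℝ E = Module.finrank ℝ (E →L[ℝ] ℝ) :=
    (Subspace.dual_finrank_eq (K := ℝ) (V := E)).symm.trans
      (LinearMap.toContinuousLinearMap : (E →ₗ[ℝ] ℝ) ≃ₗ[ℝ] (E →L[ℝ] ℝ)).finrank_eq
  refine ⟨(LinearEquiv.ofInjectiveOfFinrankEq _ hinj hfr).toContinuousLinearEquiv, ?_⟩
  ext v w
  rfl

/-- Hamiltonian vector fields of smooth functions are smooth. -/
theorem contDiffOn_hamiltonian {ω' : E → E [⋀^Fin 2]→L[ℝ] ℝ} {W : Set E} (hW : IsOpen W)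
    (hω : ContDiffOn ℝ ∞ ω' W) (hnd : ∀ x ∈ W, ∀ v, (∀ w, ω' x ![w, v] = 0) → v = 0)
    {f : V → E → ℝ} (hf : ∀ v, ContDiffOn ℝ ∞ (f v) W) {A : E → V →L[ℝ] E}
    (hA : ∀ x ∈ W, ∀ v w, ω' x ![w, A x v] = fderiv ℝ (f v) x w) : ContDiffOn ℝ ∞ A W := by
  have hG : ContDiffOn ℝ ∞ (fun x => (formBilin (ω' x)).comp (A x)) W := by
    refine contDiffOn_clm_apply.2 fun v => ?_
    refine ((hf v).fderiv_of_isOpen hW (m := ∞) (by simp)).congr fun x hx => ?_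
    ext w
    simp [formBilin_apply, hA x hx]
  have hB := contDiffOn_formBilin hω
  intro x hx
  obtain ⟨e, he⟩ := exists_equiv_formBilin (hnd x hx)
  -- Inversion is smooth at an invertible map, so `A` is recovered smoothly from `ω' ∘ A`, which
  -- consists of differentials.
  have h1 : ContDiffWithinAt ℝ ∞ (fun x => (formBilin (ω' x)).inverse) W x := by
    have := contDiffAt_map_inverse (n := ∞) e
    rw [he] at this
    exact this.comp_contDiffWithinAt x (hB x hx)
  have h2 : ∀ y ∈ W, A y = (formBilin (ω' y)).inverse.comp ((formBilin (ω' y)).comp (A y)) := by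
    intro y hy
    obtain ⟨e, he⟩ := exists_equiv_formBilin (hnd y hy)
    ext v
    simp [← he]
  exact (h1.clm_comp (hG x hx)).congr h2 (h2 x hx)

/-- Hamiltonian vector fields of functions in involution commute. -/
theorem hamiltonian_commute {ω' : E → E [⋀^Fin 2]→L[ℝ] ℝ} {W : Set E} (hW : IsOpen W)
    (hω : ContDiffOn ℝ ∞ ω' W) (hcl : ∀ x ∈ W, extDeriv ω' x = 0)
    (hnd : ∀ x ∈ W, ∀ v, (∀ w, ω' x ![w, v] = 0) → v = 0)
    {f : V → E → ℝ} (hf : ∀ v, ContDiffOn ℝ ∞ (f v) W) {A : E → V →L[ℝ] E}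
    (hA : ∀ x ∈ W, ∀ v w, ω' x ![w, A x v] = fderiv ℝ (f v) x w)
    (hinv : ∀ x ∈ W, ∀ v w, ω' x ![A x v, A x w] = 0) {x : E} (hx : x ∈ W) (v w : V) :
    fderiv ℝ A x (A x v) w = fderiv ℝ A x (A x w) v := by
  have hWx := hW.mem_nhds hx
  set B : E → E →L[ℝ] E →L[ℝ] ℝ := fun x => formBilin (ω' x) with hBdef
  have hAd : DifferentiableAt ℝ A x :=
    ((contDiffOn_hamiltonian hW hω hnd hf hA).contDiffAt hWx).differentiableAt (by simp)
  have hBd : DifferentiableAt ℝ B x :=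
    ((contDiffOn_formBilin hω).contDiffAt hWx).differentiableAt (by simp)
  have hωd : DifferentiableAt ℝ ω' x := (hω.contDiffAt hWx).differentiableAt (by simp)
  have hAv : ∀ v, HasFDerivAt (fun y => A y v) ((fderiv ℝ A x).flip v) x := fun v =>
    (ContinuousLinearMap.apply ℝ E v).hasFDerivAt.comp x hAd.hasFDerivAt
  have hBA : ∀ v, HasFDerivAt (fun y => B y (A y v))
      ((B x).comp ((fderiv ℝ A x).flip v) + (fderiv ℝ B x).flip (A x v)) x := fun v =>
    hBd.hasFDerivAt.clm_apply (hAv v)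
  -- The derivative of Hamilton's equation in the direction `z`; the right side is a Hessian, hence
  -- symmetric in `z` and `p`.
  have hH : ∀ v z p, B x (fderiv ℝ A x z v) p + fderiv ℝ B x z (A x v) p
      = fderiv ℝ (fderiv ℝ (f v)) x z p := by
    intro v z p
    have : (fun y => B y (A y v)) =ᶠ[𝓝 x] fderiv ℝ (f v) := by
      filter_upwards [hWx] with y hy
      ext w
      rw [← hA y hy]
      exact formBilin_apply _ _ _
    rw [← this.fderiv_eq, (hBA v).fderiv]
    rfl
  have hsymm : ∀ v z p, fderiv ℝ (fderiv ℝ (f v)) x z p = fderiv ℝ (fderiv ℝ (f v)) x p z := by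
    intro v z p
    exact ((hf v).contDiffAt hWx).isSymmSndFDerivAt
      (by simpa using WithTop.coe_le_coe.2 (le_top : (2 : ℕ∞) ≤ ⊤)) z p
  -- The derivative of the involution relation in the direction `z`.
  have hI : ∀ z, B x (fderiv ℝ A x z w) (A x v) + fderiv ℝ B x z (A x w) (A x v)
      + B x (A x w) (fderiv ℝ A x z v) = 0 := by
    intro z
    have h0 : (fun y => B y (A y w) (A y v)) =ᶠ[𝓝 x] fun _ => 0 := by
      filter_upwards [hWx] with y hy
      exact (formBilin_apply _ _ _).trans (hinv y hy v w)
    have h := h0.fderiv_eq (𝕜 := ℝ)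
    rw [((hBA w).clm_apply (hAv v)).fderiv] at h
    have h' := congrArg (fun L : E →L[ℝ] ℝ => L z) h
    simp at h'
    linarith
  have hswap : ∀ y a b, B y a b = - B y b a := fun y a b => by
    simp only [hBdef, formBilin_apply]
    exact form_swap _ _ _
  have hDapp : ∀ z a b, fderiv ℝ B x z a b = fderiv ℝ (fun y => ω' y ![b, a]) x z := by
    intro z a b
    have h := (hBd.hasFDerivAt.clm_apply (hasFDerivAt_const a x)).clm_apply
      (hasFDerivAt_const b x)
    have h2 : (fun y => ω' y ![b, a]) = fun y => B y a b := by
      funext y; exact (formBilin_apply _ _ _).symm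
    rw [h2, h.fderiv]
    simp
  have hcyc : ∀ a b c, fderiv ℝ B x a c b - fderiv ℝ B x b c a + fderiv ℝ B x c b a = 0 := by
    intro a b c
    have h := ((Fin.sum_univ_three _).symm.trans (extDeriv_apply hωd ![a, b, c]).symm).trans
      (congrArg (fun η : E [⋀^Fin 3]→L[ℝ] ℝ => η ![a, b, c]) (hcl x hx))
    have r0 : (0 : Fin 3).removeNth ![a, b, c] = ![b, c] := by
      ext i : 1; fin_cases i <;> rfl
    have r1 : (1 : Fin 3).removeNth ![a, b, c] = ![a, c] := by
      ext i : 1; fin_cases i <;> rfl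
    have r2 : (2 : Fin 3).removeNth ![a, b, c] = ![a, b] := by
      ext i : 1; fin_cases i <;> rfl
    rw [r0, r1, r2, ← hDapp, ← hDapp, ← hDapp] at h
    simp at h
    linarith
  -- By nondegeneracy it suffices to pair the Lie bracket with an arbitrary `p`. The pairing
  -- vanishes by a linear combination of the differentiated Hamilton equations, Hessian symmetry,
  -- the differentiated involution and `dΩ = 0`.
  rw [← sub_eq_zero]
  refine hnd x hx _ fun p => ?_
  rw [← formBilin_apply]
  change B x _ p = 0
  rw [map_sub, sub_apply]
  have e1 := hH w (A x v) p
  have e2 := hH w p (A x v)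
  have e3 := hH v (A x w) p
  have e4 := hH v p (A x w)
  have e5 := hsymm w (A x v) p
  have e6 := hsymm v (A x w) p
  have e7 := hI p
  have e8 := hcyc p (A x w) (A x v)
  have e9 := hswap x (fderiv ℝ A x p v) (A x w)
  linarith

end HamiltonianFields

/-! ### The Hamiltonian frame and its expression in charts. -/

section FlatMaps

variable {n : ℕ} {M : Type*} [TopologicalSpace M] [ChartedSpace (R2 n) M]

/-- The linear map `v ↦ ∑ vᵢ X_{fᵢ}(m)`. -/
noncomputable def hamFrame (Ω : SymplecticForm n M) (F : M → Fin n → ℝ) (m : M) :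
    (Fin n → ℝ) →L[ℝ] TangentSpace 𝓘(ℝ, R2 n) m :=
  ∑ i, (ContinuousLinearMap.proj (R := ℝ) (φ := fun _ : Fin n => ℝ) i).smulRight
    (hamVF Ω (component F i) m)

variable {Ω : SymplecticForm n M} {F : M → Fin n → ℝ}

theorem hamFrame_apply (m : M) (v : Fin n → ℝ) :
    hamFrame Ω F m v = ∑ i, v i • hamVF Ω (component F i) m := by
  simp [hamFrame]

theorem hamFrame_single (m : M) (i : Fin n) :
    hamFrame Ω F m (Pi.single i 1) = hamVF Ω (component F i) m := by
  rw [hamFrame_apply, Finset.sum_eq_single i]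
  · simp
  · intro j _ hj; simp [hj]
  · simp

theorem mfderiv_component {m : M} (hF : MDifferentiableAt 𝓘(ℝ, R2 n) 𝓘(ℝ, Fin n → ℝ) F m)
    (i : Fin n) (w : TangentSpace 𝓘(ℝ, R2 n) m) :
    mfderiv 𝓘(ℝ, R2 n) 𝓘(ℝ, ℝ) (component F i) m w
      = (mfderiv 𝓘(ℝ, R2 n) 𝓘(ℝ, Fin n → ℝ) F m w : Fin n → ℝ) i := by
  have hp : HasMFDerivAt 𝓘(ℝ, R2 n) 𝓘(ℝ, ℝ) (component F i) m
      ((ContinuousLinearMap.proj (R := ℝ) (φ := fun _ : Fin n => ℝ) i).comp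
        (mfderiv 𝓘(ℝ, R2 n) 𝓘(ℝ, Fin n → ℝ) F m)) :=
    (ContinuousLinearMap.hasMFDerivAt
      (ContinuousLinearMap.proj (R := ℝ) (φ := fun _ : Fin n => ℝ) i)).comp m hF.hasMFDerivAt
  rw [hp.mfderiv]
  rfl

theorem form_hamFrame {m : M} (hF : MDifferentiableAt 𝓘(ℝ, R2 n) 𝓘(ℝ, Fin n → ℝ) F m)
    (v : Fin n → ℝ) (w : TangentSpace 𝓘(ℝ, R2 n) m) :
    Ω.form m ![w, hamFrame Ω F m v]
      = ∑ i, v i * (mfderiv 𝓘(ℝ, R2 n) 𝓘(ℝ, Fin n → ℝ) F m w : Fin n → ℝ) i := by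
  rw [hamFrame_apply]
  refine (form_sum_right (E := R2 n) (Ω.form m) w v _).trans ?_
  refine Finset.sum_congr rfl fun i _ => ?_
  rw [← mfderiv_component hF]
  exact congrArg (v i * ·) (hamVF_spec Ω (component F i) m w)

theorem SymplecticForm.swap (m : M) (v w : TangentSpace 𝓘(ℝ, R2 n) m) :
    Ω.form m ![v, w] = - Ω.form m ![w, v] :=
  form_swap (E := R2 n) (Ω.form m) v w

theorem form_hamFrame_hamFrame (hF : IsIntegrableSystem Ω F) (m : M) (v w : Fin n → ℝ) :
    Ω.form m ![hamFrame Ω F m v, hamFrame Ω F m w] = 0 := by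
  have hFm : MDifferentiableAt 𝓘(ℝ, R2 n) 𝓘(ℝ, Fin n → ℝ) F m :=
    hF.analytic.mdifferentiableAt (by simp)
  rw [form_hamFrame hFm]
  refine Finset.sum_eq_zero fun i _ => ?_
  rw [← mfderiv_component hFm, ← hamVF_spec Ω, SymplecticForm.swap, ← hamFrame_single (Ω := Ω) (F := F), form_hamFrame hFm]
  refine mul_eq_zero_of_right _ (neg_eq_zero.2 (Finset.sum_eq_zero fun j _ => ?_))
  rw [hamFrame_single, ← mfderiv_component hFm, ← hamVF_spec Ω, hF.involution, mul_zero]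

/-- A smooth chart in which `Ω` is represented by a smooth closed form. -/
structure IsSymplecticChart (Ω : SymplecticForm n M) (e : OpenPartialHomeomorph M (R2 n)) :
    Prop where
  mem : e ∈ IsManifold.maximalAtlas 𝓘(ℝ, R2 n) ∞ M
  smooth : ContDiffOn ℝ ∞ (pullbackForm Ω.form e.symm) e.target
  closed : ∀ x ∈ e.target, extDeriv (pullbackForm Ω.form e.symm) x = 0

theorem isSymplecticChart_of_mem_analytic {e : OpenPartialHomeomorph M (R2 n)}
    (he : e ∈ IsManifold.maximalAtlas 𝓘(ℝ, R2 n) ω M) : IsSymplecticChart Ω e where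
  mem := IsManifold.maximalAtlas_subset_of_le le_top he
  smooth := (Ω.analytic e he).of_le le_top
  closed := Ω.closed e he

theorem isSymplecticChart_chartAt [IsManifold 𝓘(ℝ, R2 n) ω M] (m : M) :
    IsSymplecticChart Ω (chartAt (R2 n) m) :=
  isSymplecticChart_of_mem_analytic (IsManifold.chart_mem_maximalAtlas m)

section Chart

variable {e : OpenPartialHomeomorph M (R2 n)}

theorem mdifferentiable_of_mem_maximalAtlas
    (he : e ∈ IsManifold.maximalAtlas 𝓘(ℝ, R2 n) ∞ M) :
    e.MDifferentiable 𝓘(ℝ, R2 n) 𝓘(ℝ, R2 n) :=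
  ⟨(contMDiffOn_of_mem_maximalAtlas he).mdifferentiableOn (by simp),
    (contMDiffOn_symm_of_mem_maximalAtlas he).mdifferentiableOn (by simp)⟩

theorem IsCanonicalChart.pullbackForm_eq {m₀ : M} {r : ℝ} (he : IsCanonicalChart Ω m₀ r e)
    {x : R2 n} (hx : x ∈ e.target) (v : Fin 2 → R2 n) :
    pullbackForm Ω.form e.symm x v = stdSymplectic (v 0) (v 1) := by
  have hd := mdifferentiable_of_mem_maximalAtlas he.smooth
  have h := he.canonical (e.symm x) (e.map_target hx)
    (mfderiv 𝓘(ℝ, R2 n) 𝓘(ℝ, R2 n) e.symm x (v 0))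
    (mfderiv 𝓘(ℝ, R2 n) 𝓘(ℝ, R2 n) e.symm x (v 1))
  have hid : ∀ w : R2 n, mfderiv 𝓘(ℝ, R2 n) 𝓘(ℝ, R2 n) e (e.symm x)
      (mfderiv 𝓘(ℝ, R2 n) 𝓘(ℝ, R2 n) e.symm x w) = w := fun w =>
    congrArg (fun L : R2 n →L[ℝ] R2 n => L w) (hd.comp_symm_deriv hx)
  rw [hid, hid] at h
  rw [← h, pullbackForm]
  refine congrArg (Ω.form (e.symm x) : R2 n [⋀^Fin 2]→L[ℝ] ℝ) ?_
  ext i : 1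
  fin_cases i <;> rfl

/-- The form has constant coefficients in a canonical chart, so smoothness and closedness are
immediate although the chart is only `C^∞`. -/
theorem IsCanonicalChart.isSymplecticChart {m₀ : M} {r : ℝ}
    (he : IsCanonicalChart Ω m₀ r e) : IsSymplecticChart Ω e := by
  have hconst : ∀ x ∈ e.target, ∀ y ∈ e.target,
      pullbackForm Ω.form e.symm x = pullbackForm Ω.form e.symm y := by
    intro x hx y hy
    ext v
    rw [he.pullbackForm_eq hx, he.pullbackForm_eq hy]
  refine ⟨he.smooth, fun x hx => ?_, fun x hx => ?_⟩
  · exact contDiffWithinAt_const.congr (fun y hy => hconst y hy x hx) rfl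
  · have h : pullbackForm Ω.form e.symm =ᶠ[𝓝 x] fun _ => pullbackForm Ω.form e.symm x := by
      filter_upwards [e.open_target.mem_nhds hx] with y hy using hconst y hy x hx
    rw [h.extDeriv.eq_of_nhds]
    rw [extDeriv, fderiv_fun_const]
    exact map_zero (ContinuousAlternatingMap.alternatizeUncurryFinCLM ℝ (R2 n) ℝ)

variable (Ω F e) in
/-- The frame `X_{fᵢ}` read in the chart `e`. -/
noncomputable def localFrame (x : R2 n) : (Fin n → ℝ) →L[ℝ] R2 n :=
  (mfderiv 𝓘(ℝ, R2 n) 𝓘(ℝ, R2 n) e (e.symm x)).comp (hamFrame Ω F (e.symm x))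

theorem mfderiv_symm_localFrame (he : IsSymplecticChart Ω e) {x : R2 n} (hx : x ∈ e.target)
    (v : Fin n → ℝ) :
    mfderiv 𝓘(ℝ, R2 n) 𝓘(ℝ, R2 n) e.symm x (localFrame Ω F e x v)
      = hamFrame Ω F (e.symm x) v := by
  have h := (mdifferentiable_of_mem_maximalAtlas he.mem).symm_comp_deriv (e.map_target hx)
  rw [e.right_inv hx] at h
  exact congrArg (fun L : R2 n →L[ℝ] R2 n => L (hamFrame Ω F (e.symm x) v)) h

theorem pullbackForm_apply (ψ : R2 n → M) (x v w : R2 n) :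
    pullbackForm Ω.form ψ x ![v, w] = Ω.form (ψ x)
      ![mfderiv 𝓘(ℝ, R2 n) 𝓘(ℝ, R2 n) ψ x v, mfderiv 𝓘(ℝ, R2 n) 𝓘(ℝ, R2 n) ψ x w] := by
  refine congrArg (Ω.form (ψ x) : R2 n [⋀^Fin 2]→L[ℝ] ℝ) ?_
  ext i : 1
  fin_cases i <;> rfl

/-- Hamilton's equation for `∑ vᵢ fᵢ` in coordinates; it is the hypothesis `hA` of
`contDiffOn_hamiltonian` and `hamiltonian_commute`. -/
theorem pullbackForm_localFrame (hF : IsIntegrableSystem Ω F) (he : IsSymplecticChart Ω e)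
    {x : R2 n} (hx : x ∈ e.target) (v : Fin n → ℝ) (w : R2 n) :
    pullbackForm Ω.form e.symm x ![w, localFrame Ω F e x v]
      = fderiv ℝ (fun y => ∑ i, v i * F (e.symm y) i) x w := by
  have hd := mdifferentiable_of_mem_maximalAtlas he.mem
  have hFm : MDifferentiableAt 𝓘(ℝ, R2 n) 𝓘(ℝ, Fin n → ℝ) F (e.symm x) :=
    hF.analytic.mdifferentiableAt (by simp)
  rw [pullbackForm_apply, mfderiv_symm_localFrame he hx, form_hamFrame hFm]
  have h1 : HasFDerivAt (fun y => F (e.symm y))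
      ((mfderiv 𝓘(ℝ, R2 n) 𝓘(ℝ, Fin n → ℝ) F (e.symm x)).comp
        (mfderiv 𝓘(ℝ, R2 n) 𝓘(ℝ, R2 n) e.symm x)) x :=
    (hFm.hasMFDerivAt.comp x (hd.mdifferentiableAt_symm hx).hasMFDerivAt).hasFDerivAt
  have h2 : HasFDerivAt (fun y => ∑ i, v i * F (e.symm y) i) _ x :=
    HasFDerivAt.fun_sum fun i _ => ((hasFDerivAt_pi'.1 h1 i).const_mul (v i))
  rw [h2.fderiv, sum_apply]
  rfl

theorem contDiffOn_combination (hF : IsIntegrableSystem Ω F) (he : IsSymplecticChart Ω e)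
    (v : Fin n → ℝ) : ContDiffOn ℝ ∞ (fun y => ∑ i, v i * F (e.symm y) i) e.target := by
  have h1 : ContDiffOn ℝ ∞ (fun y => F (e.symm y)) e.target :=
    ((hF.analytic.of_le le_top).comp_contMDiffOn
      (contMDiffOn_symm_of_mem_maximalAtlas he.mem)).contDiffOn
  exact ContDiffOn.sum fun i _ => contDiffOn_const.mul (contDiffOn_pi.1 h1 i)

theorem pullbackForm_nondegenerate (he : IsSymplecticChart Ω e) {x : R2 n} (hx : x ∈ e.target)
    (v : R2 n) (hv : ∀ w, pullbackForm Ω.form e.symm x ![w, v] = 0) : v = 0 := by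
  have hd := mdifferentiable_of_mem_maximalAtlas he.mem
  have hbij := hd.symm.mfderiv_bijective (x := x) hx
  refine hbij.1 (Eq.trans ?_ (ContinuousLinearMap.map_zero _).symm)
  refine Ω.nondegenerate _ _ fun w => ?_
  obtain ⟨w, rfl⟩ := hbij.2 w
  exact (pullbackForm_apply _ _ _ _).symm.trans (hv w)

theorem contDiffOn_localFrame (hF : IsIntegrableSystem Ω F) (he : IsSymplecticChart Ω e) :
    ContDiffOn ℝ ∞ (localFrame Ω F e) e.target :=
  contDiffOn_hamiltonian e.open_target he.smooth (fun _ hx => pullbackForm_nondegenerate he hx)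
    (fun v => contDiffOn_combination hF he v) (fun _ hx => pullbackForm_localFrame hF he hx)

theorem localFrame_commute (hF : IsIntegrableSystem Ω F) (he : IsSymplecticChart Ω e)
    {x : R2 n} (hx : x ∈ e.target) (v w : Fin n → ℝ) :
    fderiv ℝ (localFrame Ω F e) x (localFrame Ω F e x v) w
      = fderiv ℝ (localFrame Ω F e) x (localFrame Ω F e x w) v := by
  refine hamiltonian_commute e.open_target he.smooth he.closed
    (fun _ hx => pullbackForm_nondegenerate he hx)
    (fun v => contDiffOn_combination hF he v) (fun _ hx => pullbackForm_localFrame hF he hx)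
    (fun y hy v w => ?_) hx v w
  rw [pullbackForm_apply, mfderiv_symm_localFrame he hy, mfderiv_symm_localFrame he hy,
    form_hamFrame_hamFrame hF]

end Chart

end FlatMaps

/-! ### Flat maps: local existence and uniqueness. -/

section FlatMaps

variable {n : ℕ} {M : Type*} [TopologicalSpace M] [ChartedSpace (R2 n) M]
  {Ω : SymplecticForm n M} {F : M → Fin n → ℝ}

/-- `Φ` is, on `Z`, an infinitesimal orbit map of the local `ℝⁿ`-action: its derivative is the
frame of Hamiltonian fields. -/
def IsFlat (Ω : SymplecticForm n M) (F : M → Fin n → ℝ) (Φ : (Fin n → ℝ) → M)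
    (Z : Set (Fin n → ℝ)) : Prop :=
  ∀ s ∈ Z, HasMFDerivAt 𝓘(ℝ, Fin n → ℝ) 𝓘(ℝ, R2 n) Φ s (hamFrame Ω F (Φ s))

variable (Ω F) in
/-- The vector field `∑ vᵢ X_{fᵢ}`. -/
noncomputable def combVF (v : Fin n → ℝ) (m : M) : TangentSpace 𝓘(ℝ, R2 n) m :=
  hamFrame Ω F m v

section

variable {e : OpenPartialHomeomorph M (R2 n)}

/-- Carries the time-one maps constructed in coordinates back to flat maps into `M`. -/
theorem hasMFDerivAt_symm_comp (he : IsSymplecticChart Ω e) {Ψ : (Fin n → ℝ) → R2 n}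
    {s : Fin n → ℝ} (hs : Ψ s ∈ e.target)
    (h : HasFDerivAt Ψ (localFrame Ω F e (Ψ s)) s) :
    HasMFDerivAt 𝓘(ℝ, Fin n → ℝ) 𝓘(ℝ, R2 n) (fun s => e.symm (Ψ s)) s
      (hamFrame Ω F (e.symm (Ψ s))) := by
  have h1 := ((mdifferentiable_of_mem_maximalAtlas he.mem).mdifferentiableAt_symm hs).hasMFDerivAt
  have h2 := HasMFDerivAt.comp s h1 h.hasMFDerivAt
  exact h2.congr_mfderiv (ContinuousLinearMap.ext fun v => mfderiv_symm_localFrame he hs v)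

theorem hasDerivWithinAt_chart_comp (he : IsSymplecticChart Ω e) {η : ℝ → M} {S : Set ℝ} {t : ℝ}
    {v : Fin n → ℝ} (ht : η t ∈ e.source)
    (h : HasMFDerivWithinAt 𝓘(ℝ, ℝ) 𝓘(ℝ, R2 n) η S t
      ((1 : ℝ →L[ℝ] ℝ).smulRight (combVF Ω F v (η t)))) :
    HasDerivWithinAt (fun t => e (η t)) (localFrame Ω F e (e (η t)) v) S t := by
  have h1 := ((mdifferentiable_of_mem_maximalAtlas he.mem).mdifferentiableAt ht).hasMFDerivAt
  have h2 : HasFDerivWithinAt (fun t => e (η t))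
      ((1 : ℝ →L[ℝ] ℝ).smulRight (localFrame Ω F e (e (η t)) v)) S t := by
    refine ((h1.comp_hasMFDerivWithinAt t h).congr_mfderiv ?_).hasFDerivWithinAt
    refine ContinuousLinearMap.ext fun (x : ℝ) => ?_
    have h3 : localFrame Ω F e (e (η t)) v
        = mfderiv 𝓘(ℝ, R2 n) 𝓘(ℝ, R2 n) e (η t) (hamFrame Ω F (η t) v) := by
      rw [localFrame, e.left_inv ht]
      rfl
    rw [h3]
    exact ContinuousLinearMap.map_smul (mfderiv 𝓘(ℝ, R2 n) 𝓘(ℝ, R2 n) e (η t)) x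
      (hamFrame Ω F (η t) v)
  exact h2.hasDerivWithinAt.congr_deriv (one_smul ℝ _)

end

theorem IsFlat.mono {Φ : (Fin n → ℝ) → M} {Z Z' : Set (Fin n → ℝ)} (h : IsFlat Ω F Φ Z)
    (hZ : Z' ⊆ Z) : IsFlat Ω F Φ Z' :=
  fun s hs => h s (hZ hs)

theorem IsFlat.continuousAt {Φ : (Fin n → ℝ) → M} {Z : Set (Fin n → ℝ)} (h : IsFlat Ω F Φ Z)
    {s : Fin n → ℝ} (hs : s ∈ Z) : ContinuousAt Φ s :=
  (h s hs).continuousAt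

theorem IsFlat.comp_add {Φ : (Fin n → ℝ) → M} {Z : Set (Fin n → ℝ)} (h : IsFlat Ω F Φ Z)
    (a : Fin n → ℝ) : IsFlat Ω F (fun s => Φ (a + s)) {s | a + s ∈ Z} := by
  intro s hs
  have h1 : HasMFDerivAt 𝓘(ℝ, Fin n → ℝ) 𝓘(ℝ, Fin n → ℝ) (fun s => a + s) s
      (ContinuousLinearMap.id ℝ (Fin n → ℝ)) := ((hasFDerivAt_id s).const_add a).hasMFDerivAt
  exact (h _ hs).comp s h1

theorem IsFlat.congr_of_eventuallyEq {Φ Φ' : (Fin n → ℝ) → M} {s : Fin n → ℝ}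
    (h : HasMFDerivAt 𝓘(ℝ, Fin n → ℝ) 𝓘(ℝ, R2 n) Φ s (hamFrame Ω F (Φ s)))
    (h' : Φ' =ᶠ[𝓝 s] Φ) :
    HasMFDerivAt 𝓘(ℝ, Fin n → ℝ) 𝓘(ℝ, R2 n) Φ' s (hamFrame Ω F (Φ' s)) := by
  have := h.congr_of_eventuallyEq h'
  rw [h'.eq_of_nhds]
  exact this

/-- Straight lines are mapped by flat maps to integral curves. -/
theorem IsFlat.isMIntegralCurveOn {Φ : (Fin n → ℝ) → M} {Z : Set (Fin n → ℝ)}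
    (h : IsFlat Ω F Φ Z) (a v : Fin n → ℝ) {S : Set ℝ} (hS : ∀ t ∈ S, a + t • v ∈ Z) :
    IsMIntegralCurveOn (I := 𝓘(ℝ, R2 n)) (fun t => Φ (a + t • v)) (combVF Ω F v) S := by
  intro t ht
  have h1 : HasFDerivAt (fun t : ℝ => a + t • v) ((1 : ℝ →L[ℝ] ℝ).smulRight v) t := by
    have := ((hasDerivAt_id t).smul_const v).const_add a
    rw [one_smul] at this
    exact this.hasFDerivAt
  have h2 := ((h _ (hS t ht)).comp t h1.hasMFDerivAt).hasMFDerivWithinAt (s := S)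
  refine h2.congr_mfderiv (ContinuousLinearMap.ext fun x => ?_)
  exact ContinuousLinearMap.map_smul _ _ _

variable [IsManifold 𝓘(ℝ, R2 n) ω M]

/-- Around every point there is a flat map. -/
theorem exists_isFlat_ball (hF : IsIntegrableSystem Ω F) (p : M) :
    ∃ ε > 0, ∃ Φ, Φ 0 = p ∧ IsFlat Ω F Φ (Metric.ball 0 ε) := by
  set e := chartAt (R2 n) p with he_def
  have he : IsSymplecticChart Ω e := isSymplecticChart_chartAt p
  have hp : p ∈ e.source := mem_chart_source _ p
  have hA := contDiffOn_localFrame hF he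
  have hcont : ContinuousAt (localFrame Ω F e) (e p) :=
    hA.continuousOn.continuousAt (e.open_target.mem_nhds (e.map_source hp))
  obtain ⟨R, hR, hball⟩ := Metric.mem_nhds_iff.1 (Filter.inter_mem
    (e.open_target.mem_nhds (e.map_source hp))
    (hcont.norm.eventually_lt_const (lt_add_one ‖localFrame Ω F e (e p)‖)))
  set κ := ‖localFrame Ω F e (e p)‖ + 1
  have hκ : 0 ≤ κ := by positivity
  -- On the ball of radius `R` the frame is bounded by `κ`, a growth bound with `α = 1`. Starting at
  -- the centre, the a priori condition reads `exp (κρ) < 1 + R`.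
  obtain ⟨ρ, hρ, hρR⟩ : ∃ ρ > 0, Real.exp (κ * ρ) < 1 + R := by
    have h1 : ContinuousAt (fun ρ => Real.exp (κ * ρ)) 0 := by fun_prop
    have h2 : ∀ᶠ ρ in 𝓝 (0 : ℝ), Real.exp (κ * ρ) < 1 + R :=
      h1.eventually_lt_const (by simpa using hR)
    obtain ⟨ρ, h3, h4⟩ := ((h2.filter_mono nhdsWithin_le_nhds).and
      (self_mem_nhdsWithin : Ioi (0 : ℝ) ∈ 𝓝[>] 0)).exists
    exact ⟨ρ, h4, h3⟩
  obtain ⟨Ψ, hΨ0, hΨ⟩ := exists_timeOne_of_commuting (A := localFrame Ω F e) (c := e p)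
    (x₀ := e p) (R := R) (α := 1) hκ zero_le_one
    ((hA.mono fun x hx => (hball hx).1).of_le (WithTop.coe_le_coe.2 (le_top : (2 : ℕ∞) ≤ ⊤)))
    (fun x hx v w => localFrame_commute hF he (hball hx).1 v w)
    (fun x hx => (hball hx).2.le.trans
      (le_mul_of_one_le_right hκ (le_add_of_nonneg_right (norm_nonneg _)))) hρ
    (by simpa using hρR)
  exact ⟨ρ, hρ, fun s => e.symm (Ψ s), by simp [hΨ0, e.left_inv hp], fun s hs =>
    hasMFDerivAt_symm_comp he (hball (hΨ s hs).1).1 (hΨ s hs).2⟩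

variable [T2Space M]

/-- Uniqueness of integral curves, with one-sided derivatives at the ends of the interval. -/
theorem combVF_integralCurve_unique (hF : IsIntegrableSystem Ω F) {v : Fin n → ℝ} {η₁ η₂ : ℝ → M}
    (h₁ : IsMIntegralCurveOn (I := 𝓘(ℝ, R2 n)) η₁ (combVF Ω F v) (Icc 0 1))
    (h₂ : IsMIntegralCurveOn (I := 𝓘(ℝ, R2 n)) η₂ (combVF Ω F v) (Icc 0 1))
    (h0 : η₁ 0 = η₂ 0) : EqOn η₁ η₂ (Icc 0 1) := by
  have hcl : IsClosed ({t | η₁ t = η₂ t} ∩ Icc 0 1) := by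
    have hc := (h₁.continuousOn.prodMk h₂.continuousOn).preimage_isClosed_of_isClosed isClosed_Icc
      (isClosed_diagonal (X := M))
    convert! hc using 1
    ext t
    simp [and_comm]
  -- The coincidence set is closed since `M` is Hausdorff. It remains to extend coincidence to the
  -- right of a point, by ODE uniqueness in a chart.
  refine hcl.Icc_subset_of_forall_mem_nhdsWithin h0 fun t₀ ⟨ht₀, ht₀'⟩ => ?_
  have ht₀'' : t₀ ∈ Icc (0 : ℝ) 1 := ⟨ht₀'.1, ht₀'.2.le⟩
  set e := chartAt (R2 n) (η₁ t₀) with he_def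
  have he : IsSymplecticChart Ω e := isSymplecticChart_chartAt _
  have hp : η₁ t₀ ∈ e.source := mem_chart_source _ _
  have hA := contDiffOn_localFrame hF he
  obtain ⟨K, U, hU, hK⟩ := ((hA.contDiffAt (e.open_target.mem_nhds (e.map_source hp))).of_le
    (WithTop.coe_le_coe.2 (le_top : (1 : ℕ∞) ≤ ⊤))
      |>.clm_apply (contDiffAt_const (c := v))).exists_lipschitzOnWith
  have hW : e.source ∩ e ⁻¹' U ∈ 𝓝 (η₁ t₀) :=
    Filter.inter_mem (e.open_source.mem_nhds hp) (e.continuousAt hp hU)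
  have hev : ∀ {η : ℝ → M}, ContinuousOn η (Icc 0 1) → η t₀ = η₁ t₀ →
      ∀ᶠ t in 𝓝[≥] t₀, η t ∈ e.source ∩ e ⁻¹' U := by
    intro η hη hηt
    have h1 : ContinuousWithinAt η (Ici t₀) t₀ := (hη t₀ ht₀'').mono_of_mem_nhdsWithin
      (Filter.mem_of_superset (Icc_mem_nhdsGE ht₀'.2) (Icc_subset_Icc_left ht₀'.1))
    exact h1 (by rwa [hηt])
  have h1 : ∀ᶠ t in 𝓝[≥] t₀, t ≤ 1 ∧ η₁ t ∈ e.source ∩ e ⁻¹' U ∧ η₂ t ∈ e.source ∩ e ⁻¹' U := by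
    filter_upwards [Icc_mem_nhdsGE ht₀'.2, hev h₁.continuousOn rfl,
      hev h₂.continuousOn ht₀.symm] with t a b c using ⟨a.2, b, c⟩
  obtain ⟨b, hb, hsub⟩ := mem_nhdsGE_iff_exists_Icc_subset.1 h1
  have hb1 : b ≤ 1 := (hsub ⟨le_of_lt hb, le_rfl⟩).1
  have hder : ∀ {η : ℝ → M}, IsMIntegralCurveOn (I := 𝓘(ℝ, R2 n)) η (combVF Ω F v) (Icc 0 1) →
      (∀ t ∈ Icc t₀ b, η t ∈ e.source ∩ e ⁻¹' U) → ∀ t ∈ Icc t₀ b,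
      HasDerivWithinAt (fun t => e (η t)) (localFrame Ω F e (e (η t)) v) (Icc 0 1) t :=
    fun h hU t ht => hasDerivWithinAt_chart_comp he (hU t ht).1
      (h t ⟨ht₀'.1.trans ht.1, ht.2.trans hb1⟩)
  have hright : ∀ {f : ℝ → R2 n} {f' : R2 n} {t : ℝ}, t ∈ Ico t₀ b →
      HasDerivWithinAt f f' (Icc 0 1) t → HasDerivWithinAt f f' (Ici t) t := fun ht h =>
    h.mono_of_mem_nhdsWithin (Filter.mem_of_superset (Icc_mem_nhdsGE (ht.2.trans_le hb1))
      (Icc_subset_Icc_left (ht₀'.1.trans ht.1)))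
  have hIcc : Icc t₀ b ⊆ Icc 0 1 := Icc_subset_Icc ht₀'.1 hb1
  have g₁ := hder h₁ fun t ht => (hsub ht).2.1
  have g₂ := hder h₂ fun t ht => (hsub ht).2.2
  have heq := ODE_solution_unique_of_mem_Icc_right (v := fun _ x => localFrame Ω F e x v)
    (s := fun _ => U) (K := K) (f := fun t => e (η₁ t)) (g := fun t => e (η₂ t)) (a := t₀) (b := b)
    (fun _ _ => hK) (fun t ht => ((g₁ t ht).continuousWithinAt).mono hIcc)
    (fun t ht => hright ht (g₁ t ⟨ht.1, ht.2.le⟩)) (fun t ht => (hsub ⟨ht.1, ht.2.le⟩).2.1.2)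
    (fun t ht => ((g₂ t ht).continuousWithinAt).mono hIcc)
    (fun t ht => hright ht (g₂ t ⟨ht.1, ht.2.le⟩)) (fun t ht => (hsub ⟨ht.1, ht.2.le⟩).2.2.2)
    (by simp only [mem_ofPred_eq] at ht₀; rw [ht₀])
  filter_upwards [Ioc_mem_nhdsGT hb] with t ht
  have ht' : t ∈ Icc t₀ b := ⟨ht.1.le, ht.2⟩
  exact e.injOn (hsub ht').2.1.1 (hsub ht').2.2.1 (heq ht')

/-- Flat maps on a convex set which agree at one point agree. -/
theorem IsFlat.eqOn (hF : IsIntegrableSystem Ω F) {Φ₁ Φ₂ : (Fin n → ℝ) → M} {Z : Set (Fin n → ℝ)}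
    (hZ : Convex ℝ Z) (h₁ : IsFlat Ω F Φ₁ Z) (h₂ : IsFlat Ω F Φ₂ Z) {a : Fin n → ℝ} (ha : a ∈ Z)
    (h : Φ₁ a = Φ₂ a) : EqOn Φ₁ Φ₂ Z := by
  intro s hs
  have hS : ∀ t ∈ Icc (0 : ℝ) 1, a + t • (s - a) ∈ Z := fun t ht =>
    hZ.add_smul_sub_mem ha hs ht
  -- On the segment from `a` to `s` both maps restrict to integral curves of the same field.
  have := combVF_integralCurve_unique hF (h₁.isMIntegralCurveOn a (s - a) hS)
    (h₂.isMIntegralCurveOn a (s - a) hS) (by simpa using h) (right_mem_Icc.2 zero_le_one)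
  simpa using this

/-- An integral curve follows a flat map along a straight line. -/
theorem IsFlat.eq_integralCurve (hF : IsIntegrableSystem Ω F) {Φ : (Fin n → ℝ) → M}
    {Z : Set (Fin n → ℝ)} (hZ : Convex ℝ Z) (h : IsFlat Ω F Φ Z) {a v : Fin n → ℝ} {T : ℝ}
    {η : ℝ → M} (hη : IsMIntegralCurveOn (I := 𝓘(ℝ, R2 n)) η (combVF Ω F v) (uIcc 0 T))
    (h0 : η 0 = Φ a) (ha : a ∈ Z) (hT : a + T • v ∈ Z) : η T = Φ (a + T • v) := by
  -- Rescaling time by `T`, which may be negative, reduces to curves on `[0, 1]`.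
  have h1 : IsMIntegralCurveOn (I := 𝓘(ℝ, R2 n)) (fun t => η (t * T))
      (combVF Ω F (T • v)) (Icc 0 1) := by
    have := hη.comp_mul T
    intro t ht
    have h2 : t * T ∈ uIcc 0 T := by
      rw [← segment_eq_uIcc]
      exact ⟨1 - t, t, by linarith [ht.2], ht.1, by ring, by simp⟩
    have h3 := (this t h2).mono (s := Icc 0 1) fun t ht => ?_
    · refine h3.congr_mfderiv (ContinuousLinearMap.ext fun (x : ℝ) => ?_)
      exact congrArg (fun w : R2 n => x • w)
        (ContinuousLinearMap.map_smul (hamFrame Ω F (η (t * T))) T v).symm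
    · change t * T ∈ uIcc 0 T
      rw [← segment_eq_uIcc]
      exact ⟨1 - t, t, by linarith [ht.2], ht.1, by ring, by simp⟩
  have hS : ∀ t ∈ Icc (0 : ℝ) 1, a + t • (T • v) ∈ Z := fun t ht => by
    have := hZ.add_smul_sub_mem ha hT ht
    simpa using this
  have := combVF_integralCurve_unique hF h1 (h.isMIntegralCurveOn a (T • v) hS)
    (by simpa using h0) (right_mem_Icc.2 zero_le_one)
  simpa using this

end FlatMaps

/-! ### Flat coordinates on the regular fibre. -/

section FlatCharts

variable {n : ℕ} {M : Type*} [TopologicalSpace M] [ChartedSpace (R2 n) M]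
  {Ω : SymplecticForm n M} {F : M → Fin n → ℝ}

theorem IsIntegrableSystem.mdifferentiableAt (hF : IsIntegrableSystem Ω F) (m : M) :
    MDifferentiableAt 𝓘(ℝ, R2 n) 𝓘(ℝ, Fin n → ℝ) F m :=
  hF.analytic.mdifferentiableAt (by simp)

theorem mfderiv_hamFrame (hF : IsIntegrableSystem Ω F) (m : M) (v : Fin n → ℝ) :
    mfderiv 𝓘(ℝ, R2 n) 𝓘(ℝ, Fin n → ℝ) F m (hamFrame Ω F m v) = (0 : Fin n → ℝ) := by
  funext i
  rw [← mfderiv_component (hF.mdifferentiableAt m), ← hamVF_spec Ω, ← hamFrame_single,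
    form_hamFrame_hamFrame hF]
  rfl

/-- The `fᵢ` are constants of motion for all the `X_{fⱼ}`, so `F ∘ Φ` has zero derivative. -/
theorem IsFlat.momentum_eq (hF : IsIntegrableSystem Ω F) {Φ : (Fin n → ℝ) → M}
    {Z : Set (Fin n → ℝ)} (hZ : Convex ℝ Z) (h : IsFlat Ω F Φ Z) {a s : Fin n → ℝ} (ha : a ∈ Z)
    (hs : s ∈ Z) : F (Φ s) = F (Φ a) := by
  have hd : ∀ s ∈ Z, HasFDerivWithinAt (fun s => F (Φ s))
      (0 : (Fin n → ℝ) →L[ℝ] (Fin n → ℝ)) Z s := fun s hs =>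
    (((hF.mdifferentiableAt (Φ s)).hasMFDerivAt.comp s (h s hs)).congr_mfderiv
      (f₁' := (0 : (Fin n → ℝ) →L[ℝ] (Fin n → ℝ))) (ContinuousLinearMap.ext fun v => mfderiv_hamFrame hF (Φ s) v)).hasFDerivAt.hasFDerivWithinAt
  have := hZ.norm_image_sub_le_of_norm_hasFDerivWithin_le hd (C := 0) (by simp) ha hs
  simpa [sub_eq_zero] using this

theorem coframe_hamFrame (hF : IsIntegrableSystem Ω F) {m : M} (hm : m ∉ singSet F)
    (v : Fin n → ℝ) (i : Fin n) : coframe Ω F i m (hamFrame Ω F m v) = v i := by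
  rw [hamFrame_apply, map_sum]
  simp [map_smul, coframe_spec Ω F i m (hF.mdifferentiableAt m) hm]

theorem hamFrame_injective (hF : IsIntegrableSystem Ω F) {m : M} (hm : m ∉ singSet F) :
    Function.Injective (hamFrame Ω F m) := fun v w h => by
  funext i
  rw [← coframe_hamFrame hF hm v i, h, coframe_hamFrame hF hm w i]

theorem mfderiv_surjective_of_notMem_singSet {m : M} (hm : m ∉ singSet F) :
    Function.Surjective (mfderiv 𝓘(ℝ, R2 n) 𝓘(ℝ, Fin n → ℝ) F m) := by
  let D : R2 n →L[ℝ] (Fin n → ℝ) := mfderiv 𝓘(ℝ, R2 n) 𝓘(ℝ, Fin n → ℝ) F m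
  have h1 : ¬ Module.finrank ℝ (LinearMap.range D.toLinearMap) < n := hm
  have h2 := Submodule.finrank_le (LinearMap.range D.toLinearMap)
  rw [Module.finrank_fin_fun] at h2
  have h3 : LinearMap.range D.toLinearMap = ⊤ := Submodule.eq_top_of_finrank_eq
    ((le_antisymm h2 (not_lt.1 h1)).trans (Module.finrank_fin_fun ℝ).symm)
  exact LinearMap.range_eq_top.1 h3

/-- If `dF` is not onto, a nonzero functional vanishes on its range. Its coefficients give a
combination of the `fᵢ` with zero differential, hence a linear relation among the `X_{fᵢ}`. -/
theorem notMem_singSet_of_injective (hF : IsIntegrableSystem Ω F) {m : M}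
    (hm : Function.Injective (hamFrame Ω F m)) : m ∉ singSet F := by
  intro hlt
  let D : R2 n →L[ℝ] (Fin n → ℝ) := mfderiv 𝓘(ℝ, R2 n) 𝓘(ℝ, Fin n → ℝ) F m
  have h1 : Module.finrank ℝ (LinearMap.range D.toLinearMap) < n := hlt
  obtain ⟨φ, hφ, hφD⟩ := Submodule.exists_dual_map_eq_bot_of_lt_top
    (p := LinearMap.range D.toLinearMap) (lt_of_le_of_ne le_top fun h => by
      rw [h, finrank_top, Module.finrank_fin_fun] at h1; exact lt_irrefl _ h1) inferInstance
  set v : Fin n → ℝ := fun i => φ (Pi.single i 1) with hv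
  have hφv : ∀ x : Fin n → ℝ, φ x = ∑ i, v i * x i := by
    intro x
    conv_lhs => rw [pi_eq_sum_univ' x]
    simp [hv, mul_comm]
  have hv0 : v = 0 := by
    refine hm ?_
    rw [map_zero]
    refine Ω.nondegenerate m _ fun w => ?_
    rw [form_hamFrame (hF.mdifferentiableAt m)]
    refine (hφv (D w)).symm.trans ?_
    have : φ (D w) ∈ Submodule.map φ (LinearMap.range D.toLinearMap) :=
      ⟨D w, ⟨w, rfl⟩, rfl⟩
    rw [hφD] at this
    exact this
  exact hφ (LinearMap.ext fun x => by rw [hφv, hv0]; simp)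

/-- A dimension count showing that at a regular point the fields `X_{fᵢ}` span the tangent space of
the fibre. -/
theorem ker_eq_range_of_finrank {E V : Type*} [AddCommGroup E] [Module ℝ E]
    [FiniteDimensional ℝ E] [AddCommGroup V] [Module ℝ V] [FiniteDimensional ℝ V]
    (hE : Module.finrank ℝ E = 2 * Module.finrank ℝ V) {D : E →ₗ[ℝ] V} {A : V →ₗ[ℝ] E}
    (hD : Function.Surjective D) (hA : Function.Injective A) (hDA : ∀ v, D (A v) = 0) :
    LinearMap.range A = LinearMap.ker D := by
  refine Submodule.eq_of_le_of_finrank_eq ?_ ?_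
  · rintro _ ⟨v, rfl⟩
    exact hDA v
  · have h1 := D.finrank_range_add_finrank_ker
    rw [LinearMap.range_eq_top.2 hD, finrank_top] at h1
    rw [LinearMap.finrank_range_of_inj hA]
    omega

/-- A left inverse, near `0`, of a flat map, defined on a neighbourhood in `M` and inverting it
on the fibre. -/
theorem exists_flat_chart [IsManifold 𝓘(ℝ, R2 n) ω M] (hF : IsIntegrableSystem Ω F) {p : M}
    (hp : p ∈ regFibre F) :
    ∃ ε > 0, ∃ (Φ : (Fin n → ℝ) → M) (T : M → Fin n → ℝ), Φ 0 = p ∧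
      IsFlat Ω F Φ (Metric.ball 0 ε) ∧ T p = 0 ∧
      ContMDiffAt 𝓘(ℝ, R2 n) 𝓘(ℝ, Fin n → ℝ) 1 T p ∧
      ∀ᶠ q in 𝓝 p, F q = 0 → T q ∈ Metric.ball 0 ε ∧ Φ (T q) = q := by
  obtain ⟨ε, hε, Φ, hΦ0, hΦ⟩ := exists_isFlat_ball hF p
  refine ⟨ε, hε, Φ, ?_⟩
  set e := chartAt (R2 n) p with he_def
  have he : IsSymplecticChart Ω e := isSymplecticChart_chartAt p
  have hd := mdifferentiable_of_mem_maximalAtlas he.mem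
  have hpe : p ∈ e.source := mem_chart_source _ p
  have hA := contDiffOn_localFrame hF he
  have h0 : (0 : Fin n → ℝ) ∈ Metric.ball (0 : Fin n → ℝ) ε := Metric.mem_ball_self hε
  -- the flat map in the chart
  have hΦsrc : ∀ᶠ s in 𝓝 (0 : Fin n → ℝ), s ∈ Metric.ball 0 ε ∧ Φ s ∈ e.source :=
    Filter.Eventually.and (Metric.isOpen_ball.mem_nhds h0)
      ((hΦ.continuousAt h0).eventually_mem (by rw [hΦ0]; exact e.open_source.mem_nhds hpe))
  have hΨd : ∀ s ∈ Metric.ball (0 : Fin n → ℝ) ε, Φ s ∈ e.source →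
      HasFDerivAt (fun s => e (Φ s)) (localFrame Ω F e (e (Φ s))) s := by
    intro s hs hse
    have h := ((hd.mdifferentiableAt hse).hasMFDerivAt.comp s (hΦ s hs)).hasFDerivAt
    have h2 : localFrame Ω F e (e (Φ s)) = (mfderiv 𝓘(ℝ, R2 n) 𝓘(ℝ, R2 n) e (Φ s)).comp
        (hamFrame Ω F (Φ s)) := by rw [localFrame, e.left_inv hse]
    rw [h2]
    exact h
  have hΨ : ContDiffAt ℝ 1 (fun s => e (Φ s)) 0 := by
    refine contDiffAt_one_iff.2 ⟨fun s => localFrame Ω F e (e (Φ s)), _, hΦsrc, ?_,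
      fun s hs => hΨd s hs.1 hs.2⟩
    intro s hs
    refine ContinuousAt.continuousWithinAt ?_
    exact (hA.continuousOn.continuousAt (e.open_target.mem_nhds (e.map_source hs.2))).comp
      (f := fun s => e (Φ s)) (hΨd s hs.1 hs.2).continuousAt
  have hΨ0 : HasFDerivAt (fun s => e (Φ s)) (localFrame Ω F e (e p)) 0 := by
    have := hΨd 0 h0 (by rwa [hΦ0])
    rwa [hΦ0] at this
  have hAp : ∀ v, localFrame Ω F e (e p) v
      = mfderiv 𝓘(ℝ, R2 n) 𝓘(ℝ, R2 n) e p (hamFrame Ω F p v) := by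
    intro v; rw [localFrame, e.left_inv hpe]; rfl
  have hAinj : Function.Injective (localFrame Ω F e (e p)) := fun v w h => by
    rw [hAp, hAp] at h
    exact hamFrame_injective hF hp.2 (hd.mfderiv_injective hpe h)
  -- `P` is a linear left inverse of the frame at `p`, so `P ∘ e ∘ Φ` has the identity as its
  -- derivative at `0`. With local inverse `g`, the flat coordinate is `T = g ∘ P ∘ e`.
  obtain ⟨P₀, hP₀⟩ := (localFrame Ω F e (e p)).toLinearMap.exists_leftInverse_of_injective
    (LinearMap.ker_eq_bot.2 hAinj)
  set P : R2 n →L[ℝ] (Fin n → ℝ) := LinearMap.toContinuousLinearMap P₀ with hPdef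
  have hP : ∀ v, P (localFrame Ω F e (e p) v) = v := fun v => LinearMap.congr_fun hP₀ v
  -- invert `P ∘ e ∘ Φ`
  have hPΨ : ContDiffAt ℝ 1 (fun s => P (e (Φ s))) 0 := P.contDiff.contDiffAt.comp 0 hΨ
  have hPΨ0 : HasFDerivAt (fun s => P (e (Φ s)))
      ((ContinuousLinearEquiv.refl ℝ (Fin n → ℝ) : (Fin n → ℝ) →L[ℝ] (Fin n → ℝ))) 0 := by
    have := P.hasFDerivAt.comp (0 : Fin n → ℝ) hΨ0
    convert! this using 1
    ext v : 1
    exact (hP v).symm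
  set g := hPΨ.localInverse hPΨ0 one_ne_zero with hg
  have hgC : ContDiffAt ℝ 1 g (P (e p)) := by
    have := hPΨ.to_localInverse hPΨ0 one_ne_zero
    simpa only [hΦ0] using this
  have hg0 : g (P (e p)) = 0 := by
    have := hPΨ.localInverse_apply_image hPΨ0 one_ne_zero
    simpa only [hΦ0] using this
  have hgr : ∀ᶠ y in 𝓝 (P (e p)), P (e (Φ (g y))) = y := by
    have := (hPΨ.hasStrictFDerivAt' hPΨ0 one_ne_zero).eventually_right_inverse
    simp only [hΦ0] at this
    exact this
  have hTC : ContMDiffAt 𝓘(ℝ, R2 n) 𝓘(ℝ, Fin n → ℝ) 1 (fun q => g (P (e q))) p := by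
    have h1 : ContMDiffAt 𝓘(ℝ, R2 n) 𝓘(ℝ, R2 n) 1 e p :=
      (contMDiffAt_of_mem_maximalAtlas he.mem hpe).of_le
        (WithTop.coe_le_coe.2 (le_top : (1 : ℕ∞) ≤ ⊤))
    have h2 : ContDiffAt ℝ 1 (fun x => g (P x)) (e p) :=
      hgC.comp (e p) P.contDiff.contDiffAt
    exact h2.contMDiffAt.comp p h1
  refine ⟨fun q => g (P (e q)), hΦ0, hΦ, hg0, hTC, ?_⟩
  -- a momentum map together with `P` separates points
  have hGC : ContDiffAt ℝ 1 (fun x => (F (e.symm x), P x)) (e p) := by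
    have h1 : ContMDiffAt 𝓘(ℝ, R2 n) 𝓘(ℝ, Fin n → ℝ) ∞ (fun x => F (e.symm x)) (e p) :=
      ((hF.analytic.of_le le_top).contMDiffAt).comp (e p)
        (contMDiffAt_symm_of_mem_maximalAtlas he.mem (e.map_source hpe))
    exact (h1.contDiffAt.of_le (WithTop.coe_le_coe.2 (le_top : (1 : ℕ∞) ≤ ⊤))).prodMk
      P.contDiff.contDiffAt
  set D : R2 n →L[ℝ] (Fin n → ℝ) := (mfderiv 𝓘(ℝ, R2 n) 𝓘(ℝ, Fin n → ℝ) F p).comp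
    (mfderiv 𝓘(ℝ, R2 n) 𝓘(ℝ, R2 n) e.symm (e p)) with hD
  have hFD : HasFDerivAt (fun x => F (e.symm x)) D (e p) := by
    have h1 := (hF.mdifferentiableAt (e.symm (e p))).hasMFDerivAt.comp (e p)
      (hd.mdifferentiableAt_symm (e.map_source hpe)).hasMFDerivAt
    rw [e.left_inv hpe] at h1
    exact h1.hasFDerivAt
  have hDsurj : Function.Surjective D :=
    (mfderiv_surjective_of_notMem_singSet hp.2).comp
      (hd.symm.mfderiv_surjective (x := e p) (e.map_source hpe))
  have hDA : ∀ v, D (localFrame Ω F e (e p) v) = 0 := by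
    intro v
    have := mfderiv_symm_localFrame (F := F) he (e.map_source hpe) v
    rw [e.left_inv hpe] at this
    exact (congrArg (mfderiv 𝓘(ℝ, R2 n) 𝓘(ℝ, Fin n → ℝ) F p) this).trans (mfderiv_hamFrame hF p v)
  have hker := ker_eq_range_of_finrank (D := D.toLinearMap)
    (A := (localFrame Ω F e (e p)).toLinearMap) (by simp) hDsurj hAinj hDA
  -- The kernel of `D` is the span of the frame, on which `P` is injective.
  have hGinj : Function.Injective (D.prod P).toLinearMap := by
    rw [← LinearMap.ker_eq_bot, LinearMap.ker_eq_bot']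
    intro x hx
    have hx' : D x = 0 ∧ P x = 0 := Prod.mk.inj hx
    have : x ∈ LinearMap.ker D.toLinearMap := hx'.1
    rw [← hker] at this
    obtain ⟨v, rfl⟩ := this
    have h2 : v = 0 := (hP v).symm.trans hx'.2
    rw [h2]
    exact map_zero _
  have hfr : Module.finrank ℝ (R2 n) = Module.finrank ℝ ((Fin n → ℝ) × (Fin n → ℝ)) := by
    simp; ring
  let Ge := (LinearEquiv.ofInjectiveOfFinrankEq _ hGinj hfr).toContinuousLinearEquiv
  have hG : HasFDerivAt (fun x => (F (e.symm x), P x))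
      (Ge : R2 n →L[ℝ] (Fin n → ℝ) × (Fin n → ℝ)) (e p) := by
    have := hFD.prodMk P.hasFDerivAt
    convert! this using 1
  have hGl := (hGC.hasStrictFDerivAt' hG one_ne_zero).eventually_left_inverse
  have hepc : ContinuousAt e p := e.continuousAt hpe
  have hTp : Filter.Tendsto (fun q => g (P (e q))) (𝓝 p) (𝓝 0) := by
    have := hTC.continuousAt.tendsto
    rwa [hg0] at this
  have hΨc : Filter.Tendsto (fun q => e (Φ (g (P (e q))))) (𝓝 p) (𝓝 (e p)) := by
    have h1 : Filter.Tendsto (fun s => e (Φ s)) (𝓝 0) (𝓝 (e p)) := by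
      have := hΨ0.continuousAt.tendsto
      simpa only [hΦ0] using this
    exact h1.comp hTp
  filter_upwards [hepc.eventually hGl, hΨc.eventually hGl, hTp.eventually hΦsrc,
    (P.continuous.continuousAt.comp hepc).eventually hgr, e.open_source.mem_nhds hpe]
    with q h1 h2 h3 h4 h5 hq
  refine ⟨h3.1, ?_⟩
  -- `Φ (T q)` and `q` have the same momentum and the same `P`-coordinate, hence coincide near `p`.
  have h6 : F (Φ (g (P (e q)))) = F q := by
    rw [hΦ.momentum_eq hF (convex_ball _ _) h0 h3.1, hΦ0, hq]
    exact hp.1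
  rw [e.left_inv h3.2, h6] at h2
  have h4' : P (e (Φ (g (P (e q))))) = P (e q) := h4
  rw [h4'] at h2
  rw [e.left_inv h5] at h1
  exact e.injOn h3.2 h5 (h2.symm.trans h1)

end FlatCharts

/-! ### Lifting curves of the regular fibre through flat maps; periods. -/

section Loops

variable {n : ℕ} {M : Type*} [TopologicalSpace M] [ChartedSpace (R2 n) M]
  {Ω : SymplecticForm n M} {F : M → Fin n → ℝ}

variable (Ω F) in
/-- The vector `(θ₁(γ̇), …, θₙ(γ̇))` of the components of the velocity of a curve. -/
noncomputable def frameSpeed (γ : ℝ → M) (t : ℝ) : Fin n → ℝ :=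
  fun i => coframe Ω F i (γ t) (velocity γ t)

/-- A curve in the image of a flat map moves with the speed of its parameter. -/
theorem frameSpeed_eq_of_eventuallyEq (hF : IsIntegrableSystem Ω F) {γ : ℝ → M}
    {Φ : (Fin n → ℝ) → M} {Z : Set (Fin n → ℝ)} (hΦ : IsFlat Ω F Φ Z) {τ : ℝ → Fin n → ℝ}
    {τ' : Fin n → ℝ} {t : ℝ} (hτ : HasDerivAt τ τ' t) (ht : τ t ∈ Z)
    (hγ : γ =ᶠ[𝓝 t] fun t => Φ (τ t)) (hreg : γ t ∉ singSet F) : frameSpeed Ω F γ t = τ' := by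
  have h1 := ((hΦ _ ht).comp t hτ.hasFDerivAt.hasMFDerivAt).congr_of_eventuallyEq hγ
  have hγt : γ t = Φ (τ t) := hγ.eq_of_nhds
  have h2 : velocity γ t = (hamFrame Ω F (Φ (τ t)) τ' : R2 n) := by
    rw [velocity, h1.mfderiv]
    exact congrArg (hamFrame Ω F (Φ (τ t))) (one_smul ℝ τ')
  funext i
  rw [frameSpeed, h2, hγt]
  exact coframe_hamFrame hF (by rwa [← hγt]) _ _

/-- In the interior the frame speed is the derivative of the lift `τ`. At the endpoints `velocity`
is a two-sided derivative and may take its default value, which the integral does not see. -/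
theorem frameSpeed_integral_of_flat (hF : IsIntegrableSystem Ω F) {γ : ℝ → M} {a b : ℝ}
    (hab : a < b) {Φ : (Fin n → ℝ) → M} {Z : Set (Fin n → ℝ)} (hΦ : IsFlat Ω F Φ Z)
    {τ : ℝ → Fin n → ℝ} (hτ : ContDiffOn ℝ 1 τ (Icc a b)) (hτZ : ∀ t ∈ Icc a b, τ t ∈ Z)
    (hγ : ∀ t ∈ Icc a b, Φ (τ t) = γ t) (hreg : ∀ t ∈ Icc a b, γ t ∉ singSet F) :
    MeasureTheory.IntegrableOn (frameSpeed Ω F γ) (Icc a b) ∧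
      ∀ s ∈ Icc a b, ∀ t ∈ Icc a b, ∫ x in s..t, frameSpeed Ω F γ x = τ t - τ s := by
  have hder : ∀ t ∈ Ioo a b, HasDerivAt τ (derivWithin τ (Icc a b) t) t := fun t ht =>
    ((hτ.differentiableOn one_ne_zero t (Ioo_subset_Icc_self ht)).hasDerivWithinAt).hasDerivAt
      (Icc_mem_nhds ht.1 ht.2)
  have hsp : ∀ t ∈ Ioo a b, frameSpeed Ω F γ t = derivWithin τ (Icc a b) t := fun t ht =>
    frameSpeed_eq_of_eventuallyEq hF hΦ (hder t ht) (hτZ t (Ioo_subset_Icc_self ht))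
      (by filter_upwards [Icc_mem_nhds ht.1 ht.2] with s hs using (hγ s hs).symm)
      (hreg t (Ioo_subset_Icc_self ht))
  have hint : MeasureTheory.IntegrableOn (frameSpeed Ω F γ) (Icc a b) := by
    rw [integrableOn_Icc_iff_integrableOn_Ioo]
    have h1 : MeasureTheory.IntegrableOn (derivWithin τ (Icc a b)) (Icc a b) :=
      (hτ.continuousOn_derivWithin (uniqueDiffOn_Icc hab) le_rfl).integrableOn_Icc
    exact (h1.mono_set Ioo_subset_Icc_self).congr_fun (fun t ht => (hsp t ht).symm)
      measurableSet_Ioo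
  have hle : ∀ s ∈ Icc a b, ∀ t ∈ Icc a b, s ≤ t →
      ∫ x in s..t, frameSpeed Ω F γ x = τ t - τ s := by
    intro s hs t ht hst
    have hsub : Icc s t ⊆ Icc a b := Icc_subset_Icc hs.1 ht.2
    refine intervalIntegral.integral_eq_sub_of_hasDerivAt_of_le hst (hτ.continuousOn.mono hsub)
      (fun x hx => ?_) ((hint.mono_set (by rwa [uIcc_of_le hst])).intervalIntegrable)
    have hx' : x ∈ Ioo a b := ⟨hs.1.trans_lt hx.1, hx.2.trans_le ht.2⟩
    rw [hsp x hx']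
    exact hder x hx'
  refine ⟨hint, fun s hs t ht => ?_⟩
  rcases le_total s t with h | h
  · exact hle s hs t ht h
  · rw [intervalIntegral.integral_symm, hle t ht s hs h, neg_sub]

variable [IsManifold 𝓘(ℝ, R2 n) ω M]

/-- Near each of its points, a `C¹` arc in the regular fibre is the image under a flat map of
the integral of its frame speed. -/
theorem exists_nhds_frameSpeed_integral (hF : IsIntegrableSystem Ω F) {γ : ℝ → M} {a b t₀ ε : ℝ}
    (hγ : ContMDiffOn 𝓘(ℝ, ℝ) 𝓘(ℝ, R2 n) 1 γ (Icc a b))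
    (hreg : ∀ t ∈ Icc a b, γ t ∈ regFibre F) (ht₀ : t₀ ∈ Icc a b) (hε : 0 < ε)
    {Φ : (Fin n → ℝ) → M} {T : M → Fin n → ℝ} (hΦ0 : Φ 0 = γ t₀)
    (hΦ : IsFlat Ω F Φ (Metric.ball 0 ε)) (hT0 : T (γ t₀) = 0)
    (hT : ContMDiffAt 𝓘(ℝ, R2 n) 𝓘(ℝ, Fin n → ℝ) 1 T (γ t₀))
    (hΦT : ∀ᶠ q in 𝓝 (γ t₀), F q = 0 → T q ∈ Metric.ball 0 ε ∧ Φ (T q) = q) :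
    ∃ J ∈ 𝓝[Icc a b] t₀, MeasureTheory.IntegrableOn (frameSpeed Ω F γ) J ∧
      ∀ t ∈ J, ∫ x in t₀..t, frameSpeed Ω F γ x ∈ Metric.ball 0 ε ∧
        Φ (∫ x in t₀..t, frameSpeed Ω F γ x) = γ t := by
  -- The subdivision of a loop is only monotone, so a piece may be a single point.
  rcases (ht₀.1.trans ht₀.2).eq_or_lt with rfl | hab
  · obtain rfl : t₀ = a := le_antisymm ht₀.2 ht₀.1
    refine ⟨{t₀}, ?_, by simp, ?_⟩
    · rw [Icc_self]
      exact self_mem_nhdsWithin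
    · rintro t rfl
      simp [hε, hΦ0]
  have hcont : ContinuousWithinAt γ (Icc a b) t₀ := hγ.continuousOn t₀ ht₀
  have hev : ∀ᶠ t in 𝓝[Icc a b] t₀, (T (γ t) ∈ Metric.ball 0 ε ∧ Φ (T (γ t)) = γ t) ∧
      ContMDiffAt 𝓘(ℝ, R2 n) 𝓘(ℝ, Fin n → ℝ) 1 T (γ t) := by
    filter_upwards [hcont.eventually hΦT, hcont.eventually ((contMDiffAt_iff_contMDiffAt_nhds (by simp)).1 hT),
      self_mem_nhdsWithin] with t h1 h2 h3 using ⟨h1 (hreg t h3).1, h2⟩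
  obtain ⟨δ, hδ, hsub⟩ := Metric.mem_nhdsWithin_iff.1 hev
  set a' := max a (t₀ - δ / 2)
  set b' := min b (t₀ + δ / 2)
  have ha' : a' ≤ t₀ := max_le ht₀.1 (by linarith)
  have hb' : t₀ ≤ b' := le_min ht₀.2 (by linarith)
  have hab' : a' < b' := by
    refine max_lt (lt_min hab ?_) (lt_min ?_ ?_) <;> linarith [ht₀.1, ht₀.2]
  have hsub1 : Icc a' b' ⊆ Icc a b := Icc_subset_Icc (le_max_left _ _) (min_le_left _ _)
  have hsub2 : Icc a' b' ⊆ Metric.ball t₀ δ ∩ Icc a b := fun t ht => by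
    refine ⟨?_, hsub1 ht⟩
    have h1 := (le_max_right a (t₀ - δ / 2)).trans ht.1
    have h2 := ht.2.trans (min_le_right b (t₀ + δ / 2))
    rw [Metric.mem_ball, Real.dist_eq, abs_lt]
    constructor <;> linarith
  have hnhds : Icc a' b' ∈ 𝓝[Icc a b] t₀ := by
    rw [Metric.mem_nhdsWithin_iff]
    refine ⟨δ / 2, by linarith, fun t ht => ?_⟩
    have h1 := ht.1
    rw [Metric.mem_ball, Real.dist_eq, abs_lt] at h1
    exact ⟨max_le ht.2.1 (by linarith), le_min ht.2.2 (by linarith)⟩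
  have hC : ContDiffOn ℝ 1 (fun t => T (γ t)) (Icc a' b') := by
    intro t ht
    have h1 := (hsub (hsub2 ht)).2
    exact (h1.comp_contMDiffWithinAt t ((hγ t (hsub1 ht)).mono hsub1)).contDiffWithinAt
  obtain ⟨hint, hI⟩ := frameSpeed_integral_of_flat hF hab' hΦ hC
    (fun t ht => (hsub (hsub2 ht)).1.1) (fun t ht => (hsub (hsub2 ht)).1.2)
    (fun t ht => (hreg t (hsub1 ht)).2)
  refine ⟨_, hnhds, hint, fun t ht => ?_⟩
  rw [hI t₀ ⟨ha', hb'⟩ t ht, hT0, sub_zero]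
  exact (hsub (hsub2 ht)).1

/-- Flat coordinates give integrability near each point; compactness of the interval does the rest.
-/
theorem integrableOn_frameSpeed (hF : IsIntegrableSystem Ω F) {γ : ℝ → M} {a b : ℝ}
    (hγ : ContMDiffOn 𝓘(ℝ, ℝ) 𝓘(ℝ, R2 n) 1 γ (Icc a b))
    (hreg : ∀ t ∈ Icc a b, γ t ∈ regFibre F) :
    MeasureTheory.IntegrableOn (frameSpeed Ω F γ) (Icc a b) := by
  refine isCompact_Icc.induction_on MeasureTheory.integrableOn_empty
    (fun _ _ h h' => h'.mono_set h) (fun _ _ h h' => h.union h') fun t₀ ht₀ => ?_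
  obtain ⟨ε, hε, Φ, T, hΦ0, hΦ, hT0, hT, hΦT⟩ := exists_flat_chart hF (hreg t₀ ht₀)
  obtain ⟨J, hJ, hJi, -⟩ := exists_nhds_frameSpeed_integral hF hγ hreg ht₀ hε hΦ0 hΦ hT0 hT hΦT
  exact ⟨J, hJ, hJi⟩

theorem exists_mem_Icc_of_monotone {τ : ℕ → ℝ} {t : ℝ} (h0 : τ 0 ≤ t) :
    ∀ {N : ℕ}, t ≤ τ N → t = τ 0 ∨ ∃ k < N, t ∈ Icc (τ k) (τ (k + 1)) := by
  intro N
  induction N with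
  | zero => exact fun h => Or.inl (le_antisymm h h0)
  | succ N ih =>
    intro h
    rcases le_total t (τ N) with h' | h'
    · exact (ih h').imp_right fun ⟨k, hk, hkt⟩ => ⟨k, hk.trans (Nat.lt_succ_self _), hkt⟩
    · exact Or.inr ⟨N, Nat.lt_succ_self _, h', h⟩

theorem IsPiecewiseC1Loop.intervalIntegrable_frameSpeed (hF : IsIntegrableSystem Ω F) {γ : ℝ → M}
    (hγ : IsPiecewiseC1Loop (n := n) γ) (hreg : ∀ t ∈ Icc (0 : ℝ) 1, γ t ∈ regFibre F) :
    IntervalIntegrable (frameSpeed Ω F γ) MeasureTheory.volume 0 1 := by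
  obtain ⟨N, τ, hmono, h0, hN, hC⟩ := hγ.piecewise_C1
  rw [← h0, ← hN]
  refine IntervalIntegrable.trans_iterate fun k hk => ?_
  have hsub : Icc (τ k) (τ (k + 1)) ⊆ Icc 0 1 :=
    Icc_subset_Icc (h0 ▸ hmono (Nat.zero_le _)) (hN ▸ hmono hk)
  refine MeasureTheory.IntegrableOn.intervalIntegrable ?_
  rw [uIcc_of_le (hmono (Nat.le_succ k))]
  exact integrableOn_frameSpeed hF (hC k hk) fun t ht => hreg t (hsub ht)

/-- A loop in the regular fibre is, near each of its points, the image under a flat map of the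
integral of its frame speed. -/
theorem IsPiecewiseC1Loop.exists_flat (hF : IsIntegrableSystem Ω F) {γ : ℝ → M}
    (hγ : IsPiecewiseC1Loop (n := n) γ) (hreg : ∀ t ∈ Icc (0 : ℝ) 1, γ t ∈ regFibre F)
    {t₀ : ℝ} (ht₀ : t₀ ∈ Icc (0 : ℝ) 1) :
    ∃ ε > 0, ∃ Φ, Φ 0 = γ t₀ ∧ IsFlat Ω F Φ (Metric.ball 0 ε) ∧ ∀ᶠ t in 𝓝[Icc 0 1] t₀,
      ∫ x in t₀..t, frameSpeed Ω F γ x ∈ Metric.ball 0 ε ∧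
        Φ (∫ x in t₀..t, frameSpeed Ω F γ x) = γ t := by
  obtain ⟨N, τ, hmono, h0, hN, hC⟩ := hγ.piecewise_C1
  obtain ⟨ε, hε, Φ, T, hΦ0, hΦ, hT0, hT, hΦT⟩ := exists_flat_chart hF (hreg t₀ ht₀)
  refine ⟨ε, hε, Φ, hΦ0, hΦ, ?_⟩
  have hcov : Icc (0 : ℝ) 1 ⊆ ⋃ k ∈ Iio N, Icc (τ k) (τ (k + 1)) := by
    intro t ht
    rw [← h0, ← hN] at ht
    simp only [mem_iUnion, mem_Iio, exists_prop]
    rcases exists_mem_Icc_of_monotone ht.1 ht.2 with h | h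
    · refine ⟨0, Nat.pos_of_ne_zero ?_, h.ge, h.trans_le (hmono (Nat.le_succ 0))⟩
      rintro rfl
      rw [h0] at hN
      exact zero_ne_one hN
    · exact h
  refine Filter.Eventually.filter_mono (nhdsWithin_mono t₀ hcov) ?_
  -- The neighbourhood filter of `t₀` splits into those of the finitely many pieces. One and the
  -- same flat map serves on both sides of a corner, and pieces away from `t₀` contribute the
  -- trivial filter.
  rw [nhdsWithin_biUnion (finite_Iio N)]
  simp only [Filter.eventually_iSup]
  intro k hk
  by_cases ht : t₀ ∈ Icc (τ k) (τ (k + 1))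
  · have hsub : Icc (τ k) (τ (k + 1)) ⊆ Icc 0 1 :=
      Icc_subset_Icc (h0 ▸ hmono (Nat.zero_le _)) (hN ▸ hmono hk)
    obtain ⟨J, hJ, -, hJ'⟩ := exists_nhds_frameSpeed_integral hF (hC k hk)
      (fun t ht => hreg t (hsub ht)) ht hε hΦ0 hΦ hT0 hT hΦT
    exact Filter.mem_of_superset hJ hJ'
  · rw [notMem_closure_iff_nhdsWithin_eq_bot.1 (by rwa [isClosed_Icc.closure_eq])]
    exact Filter.eventually_bot

theorem IsPiecewiseC1Loop.loopIntegral_eq (hF : IsIntegrableSystem Ω F) {γ : ℝ → M}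
    (hγ : IsPiecewiseC1Loop (n := n) γ) (hreg : ∀ t ∈ Icc (0 : ℝ) 1, γ t ∈ regFibre F)
    (i : Fin n) : loopIntegral Ω F i γ = (∫ t in (0 : ℝ)..1, frameSpeed Ω F γ t) i :=
  (ContinuousLinearMap.proj (R := ℝ) (φ := fun _ : Fin n => ℝ) i).intervalIntegral_comp_comm
    (hγ.intervalIntegrable_frameSpeed hF hreg)

/-- The parameter space carries the sup norm, which is at most the Euclidean norm that defines `ds`.
-/
theorem IsPiecewiseC1Loop.norm_integral_le_loopLength (hF : IsIntegrableSystem Ω F) {γ : ℝ → M}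
    (hγ : IsPiecewiseC1Loop (n := n) γ) (hreg : ∀ t ∈ Icc (0 : ℝ) 1, γ t ∈ regFibre F)
    {s t : ℝ} (hs : s ∈ Icc (0 : ℝ) 1) (ht : t ∈ Icc (0 : ℝ) 1) :
    ‖∫ x in s..t, frameSpeed Ω F γ x‖ ≤ loopLength Ω F γ := by
  have hi := hγ.intervalIntegrable_frameSpeed hF hreg
  have hg := (intervalIntegrable_iff_integrableOn_Ioc_of_le zero_le_one).1 hi
  have hgi : ∀ i, MeasureTheory.IntegrableOn (fun x => frameSpeed Ω F γ x i) (Ioc 0 1) :=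
    fun i => (ContinuousLinearMap.proj (R := ℝ) (φ := fun _ : Fin n => ℝ) i).integrable_comp hg
  set q : ℝ → ℝ := fun x => Real.sqrt (∑ i, (frameSpeed Ω F γ x i) ^ 2) with hq
  have hle : ∀ x, ‖frameSpeed Ω F γ x‖ ≤ q x := fun x => by
    refine (pi_norm_le_iff_of_nonneg (Real.sqrt_nonneg _)).2 fun i => ?_
    refine Real.le_sqrt_of_sq_le ?_
    rw [Real.norm_eq_abs, sq_abs]
    exact Finset.single_le_sum (f := fun i => frameSpeed Ω F γ x i ^ 2)
      (fun i _ => sq_nonneg _) (Finset.mem_univ i)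
  -- The Euclidean norm is dominated by the sum of the absolute values of the components.
  have hqi : MeasureTheory.IntegrableOn q (Ioc 0 1) := by
    have hsum : MeasureTheory.IntegrableOn (fun x => ∑ i, |frameSpeed Ω F γ x i|) (Ioc 0 1) :=
      MeasureTheory.integrable_finsetSum _ fun i _ => (hgi i).abs
    refine hsum.mono' ?_ (Filter.Eventually.of_forall fun x => ?_)
    · have h1 : MeasureTheory.AEStronglyMeasurable
          (fun x => ∑ i, (frameSpeed Ω F γ x i) ^ 2)
          (MeasureTheory.volume.restrict (Ioc 0 1)) :=
        Finset.aestronglyMeasurable_fun_sum _ fun i _ => (hgi i).aestronglyMeasurable.pow 2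
      exact Real.continuous_sqrt.comp_aestronglyMeasurable h1
    · rw [Real.norm_of_nonneg (Real.sqrt_nonneg _)]
      refine Real.sqrt_le_iff.2 ⟨Finset.sum_nonneg fun i _ => abs_nonneg _, ?_⟩
      have := Finset.sum_sq_le_sq_sum_of_nonneg (s := Finset.univ)
        (f := fun i => |frameSpeed Ω F γ x i|) (fun i _ => abs_nonneg _)
      simpa [sq_abs] using this
  have hsub : uIoc s t ⊆ Ioc 0 1 := by
    rw [uIoc]
    exact Ioc_subset_Ioc (le_min hs.1 ht.1) (max_le hs.2 ht.2)
  calc ‖∫ x in s..t, frameSpeed Ω F γ x‖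
      ≤ ∫ x in uIoc s t, ‖frameSpeed Ω F γ x‖ :=
        intervalIntegral.norm_integral_le_integral_norm_uIoc
    _ ≤ ∫ x in uIoc s t, q x := MeasureTheory.setIntegral_mono (hg.mono_set hsub).norm
        (hqi.mono_set hsub) hle
    _ ≤ ∫ x in Ioc 0 1, q x := MeasureTheory.setIntegral_mono_set hqi
        (Filter.Eventually.of_forall fun x => Real.sqrt_nonneg _)
        (LE.le.eventuallyLE hsub)
    _ = loopLength Ω F γ := by
        rw [loopLength, intervalIntegral.integral_of_le zero_le_one]
        rfl

variable [T2Space M]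

/-- A loop in the regular fibre lies in the image of any flat map which starts on the loop and is
defined on a ball of radius larger than the length of the loop; and the displacement along the
loop is a period of the flat map. -/
theorem IsPiecewiseC1Loop.flat_period (hF : IsIntegrableSystem Ω F) {γ : ℝ → M}
    (hγ : IsPiecewiseC1Loop (n := n) γ) (hreg : ∀ t ∈ Icc (0 : ℝ) 1, γ t ∈ regFibre F)
    {Φ : (Fin n → ℝ) → M} {ρ : ℝ} (hΦ : IsFlat Ω F Φ (Metric.ball 0 ρ))
    (hρ : loopLength Ω F γ < ρ) {t₁ : ℝ} (ht₁ : t₁ ∈ Icc (0 : ℝ) 1) (hΦ0 : Φ 0 = γ t₁) :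
    Φ (∫ t in (0 : ℝ)..1, frameSpeed Ω F γ t) = Φ 0 := by
  have hi := hγ.intervalIntegrable_frameSpeed hF hreg
  have hii : ∀ {s t : ℝ}, s ∈ Icc (0 : ℝ) 1 → t ∈ Icc (0 : ℝ) 1 →
      IntervalIntegrable (frameSpeed Ω F γ) MeasureTheory.volume s t := fun hs ht =>
    hi.mono_set (by rw [uIcc_of_le (zero_le_one' ℝ)]; exact uIcc_subset_Icc hs ht)
  set σ : ℝ → Fin n → ℝ := fun t => ∫ x in t₁..t, frameSpeed Ω F γ x with hσ
  have hball : ∀ s ∈ Icc (0 : ℝ) 1, ∀ t ∈ Icc (0 : ℝ) 1,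
      ∫ x in s..t, frameSpeed Ω F γ x ∈ Metric.ball (0 : Fin n → ℝ) ρ := fun s hs t ht => by
    rw [mem_ball_zero_iff]
    exact (hγ.norm_integral_le_loopLength hF hreg hs ht).trans_lt hρ
  have hσadd : ∀ s ∈ Icc (0 : ℝ) 1, ∀ t ∈ Icc (0 : ℝ) 1,
      σ s + ∫ x in s..t, frameSpeed Ω F γ x = σ t := fun s hs t ht =>
    intervalIntegral.integral_add_adjacent_intervals (hii ht₁ hs) (hii hs ht)
  have hlift : ∀ t ∈ Icc (0 : ℝ) 1, γ t = Φ (σ t) := by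
    intro t ht
    -- Agreement of `γ` with its candidate lift is locally constant in time: near `s` both are
    -- governed by a flat map based at `γ s`, and flat maps agreeing at one point of a convex set
    -- agree on it.
    have key : (γ t₁ = Φ (σ t₁)) ↔ (γ t = Φ (σ t)) := by
      refine (isPreconnected_Icc (a := (0 : ℝ)) (b := 1)).induction₂
        (fun s t => (γ s = Φ (σ s)) ↔ (γ t = Φ (σ t))) (fun s hs => ?_)
        (fun _ _ _ _ _ _ h h' => h.trans h') (fun _ _ _ _ h => h.symm) ht₁ ht
      obtain ⟨ε, hε, Φ₀, hΦ₀0, hΦ₀, hev⟩ := hγ.exists_flat hF hreg hs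
      filter_upwards [hev, self_mem_nhdsWithin] with t ht ht'
      set v := ∫ x in s..t, frameSpeed Ω F γ x with hv
      set Z : Set (Fin n → ℝ) := Metric.ball 0 ε ∩ {v | σ s + v ∈ Metric.ball 0 ρ} with hZdef
      have hZ : Convex ℝ Z := by
        refine (convex_ball _ _).inter ?_
        exact (convex_ball (0 : Fin n → ℝ) ρ).translate_preimage_right (σ s)
      have h1 : IsFlat Ω F Φ₀ Z := hΦ₀.mono inter_subset_left
      have h2 : IsFlat Ω F (fun v => Φ (σ s + v)) Z := (hΦ.comp_add (σ s)).mono inter_subset_right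
      have h0Z : (0 : Fin n → ℝ) ∈ Z :=
        ⟨Metric.mem_ball_self hε, by simpa using hball t₁ ht₁ s hs⟩
      have hvZ : v ∈ Z := ⟨ht.1, by
        change σ s + v ∈ Metric.ball 0 ρ
        rw [hv, hσadd s hs t ht']; exact hball t₁ ht₁ t ht'⟩
      rw [← hσadd s hs t ht', ← hv, ← ht.2, ← hΦ₀0]
      constructor
      · intro h
        exact IsFlat.eqOn hF hZ h1 h2 h0Z (by simpa using h) hvZ
      · intro h
        simpa using IsFlat.eqOn hF hZ h1 h2 hvZ h h0Z
    refine key.1 ?_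
    simp [hσ, hΦ0]
  have h01 : (0 : ℝ) ∈ Icc (0 : ℝ) 1 := ⟨le_rfl, zero_le_one⟩
  have h11 : (1 : ℝ) ∈ Icc (0 : ℝ) 1 := ⟨zero_le_one, le_rfl⟩
  -- As the loop closes, `Φ (σ 0) = Φ (σ 1)`. The translates of `Φ` by `σ 0` and `σ 1` then agree on
  -- `Z`, and evaluating them at `-σ 0` gives the period `σ 1 - σ 0` at the base point.
  set Z : Set (Fin n → ℝ) := {v | σ 0 + v ∈ Metric.ball 0 ρ} ∩ {v | σ 1 + v ∈ Metric.ball 0 ρ}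
    with hZdef
  have hZ : Convex ℝ Z := ((convex_ball (0 : Fin n → ℝ) ρ).translate_preimage_right (σ 0)).inter
    ((convex_ball (0 : Fin n → ℝ) ρ).translate_preimage_right (σ 1))
  have h1 : IsFlat Ω F (fun v => Φ (σ 0 + v)) Z := (hΦ.comp_add (σ 0)).mono inter_subset_left
  have h2 : IsFlat Ω F (fun v => Φ (σ 1 + v)) Z := (hΦ.comp_add (σ 1)).mono inter_subset_right
  have hσ1 : σ 1 + -σ 0 = ∫ t in (0 : ℝ)..1, frameSpeed Ω F γ t := by
    rw [← hσadd 0 h01 1 h11]; abel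
  have h0Z : (0 : Fin n → ℝ) ∈ Z :=
    ⟨by simpa using hball t₁ ht₁ 0 h01, by simpa using hball t₁ ht₁ 1 h11⟩
  have hvZ : -σ 0 ∈ Z := by
    refine ⟨?_, ?_⟩
    · change σ 0 + -σ 0 ∈ Metric.ball (0 : Fin n → ℝ) ρ
      rw [add_neg_cancel]
      simpa using hball 0 h01 0 h01
    · change σ 1 + -σ 0 ∈ Metric.ball (0 : Fin n → ℝ) ρ
      rw [hσ1]
      exact hball 0 h01 1 h11
  have := IsFlat.eqOn hF hZ h1 h2 h0Z
    (by simp only [add_zero]; rw [← hlift 0 h01, ← hlift 1 h11, hγ.closed]) hvZ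
  simp only [add_neg_cancel, hσ1] at this
  exact this.symm

end Loops

/-! ### The momentum map with replaced first component; orbits and periods along a path. -/

section Periodic

variable {n : ℕ} {M : Type*} [TopologicalSpace M] [ChartedSpace (R2 n) M]
  {Ω : SymplecticForm n M} {F : M → Fin n → ℝ}

theorem hamVF_eq_of_forall {f : M → ℝ} {m : M} {X : TangentSpace 𝓘(ℝ, R2 n) m}
    (h : ∀ w, Ω.form m ![w, X] = mfderiv 𝓘(ℝ, R2 n) 𝓘(ℝ, ℝ) f m w) : hamVF Ω f m = X := by
  have h1 : ∀ w : R2 n, formBilin (E := R2 n) (Ω.form m) (hamVF Ω f m) w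
      = formBilin (E := R2 n) (Ω.form m) X w := fun w =>
    (formBilin_apply (E := R2 n) (Ω.form m) _ w).trans
      (((hamVF_spec Ω f m w).trans (h w).symm).trans
        (formBilin_apply (E := R2 n) (Ω.form m) X w).symm)
  obtain ⟨e, he⟩ := exists_equiv_formBilin (E := R2 n) (η := Ω.form m) (Ω.nondegenerate m)
  refine e.injective (ContinuousLinearMap.ext fun w => ?_)
  have h2 := h1 w
  rw [← he] at h2
  exact h2

theorem hamFrame_eq_zero_of_rankAt {m : M}
    (hF : MDifferentiableAt 𝓘(ℝ, R2 n) 𝓘(ℝ, Fin n → ℝ) F m) (hm : rankAt F m = 0)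
    (v : Fin n → ℝ) : hamFrame Ω F m v = 0 := by
  refine Ω.nondegenerate m _ fun w => ?_
  rw [form_hamFrame hF]
  let D : R2 n →L[ℝ] (Fin n → ℝ) := mfderiv 𝓘(ℝ, R2 n) 𝓘(ℝ, Fin n → ℝ) F m
  have h1 : LinearMap.range D.toLinearMap = ⊥ := Submodule.finrank_eq_zero.1 hm
  have h2 : D.toLinearMap = 0 := LinearMap.range_eq_bot.1 h1
  have h3 : D w = 0 := LinearMap.congr_fun h2 w
  refine Finset.sum_eq_zero fun i _ => ?_
  exact mul_eq_zero_of_right _ (congrFun h3 i)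

variable [NeZero n]

theorem hamVF_replaceFirst_zero (hF : IsIntegrableSystem Ω F) (a : Fin n → ℝ) :
    hamVF Ω (component (replaceFirst F a) 0) = combVF Ω F a := by
  funext m
  refine hamVF_eq_of_forall fun w => ?_
  have hFm := hF.mdifferentiableAt m
  refine (form_hamFrame hFm a w).trans ?_
  let L : (Fin n → ℝ) →L[ℝ] ℝ :=
    ∑ i, a i • ContinuousLinearMap.proj (R := ℝ) (φ := fun _ : Fin n => ℝ) i
  have hL : ∀ x, L x = ∑ i, a i * x i := fun x => by simp [L]
  have h1 : component (replaceFirst F a) 0 = L ∘ F := by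
    funext m
    simp [component, replaceFirst, hL]
  have h2 : HasMFDerivAt 𝓘(ℝ, R2 n) 𝓘(ℝ, ℝ) (L ∘ F) m
      (L.comp (mfderiv 𝓘(ℝ, R2 n) 𝓘(ℝ, Fin n → ℝ) F m)) :=
    (ContinuousLinearMap.hasMFDerivAt L).comp m hFm.hasMFDerivAt
  rw [h1, h2.mfderiv]
  exact (hL _).symm

theorem hamVF_replaceFirst_of_ne {i : Fin n} (hi : i ≠ 0) (a : Fin n → ℝ) :
    hamVF Ω (component (replaceFirst F a) i) = combVF Ω F (Pi.single i 1) := by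
  funext m
  have h1 : component (replaceFirst F a) i = component F i := by
    funext m
    simp [component, replaceFirst, hi]
  rw [h1]
  exact (hamFrame_single m i).symm

omit [NeZero n] in
/-- The relation of lying on the same orbit is symmetric. -/
theorem hamOrbit_symm {G : M → Fin n → ℝ} {p q : M} (h : q ∈ hamOrbit Ω G p) :
    p ∈ hamOrbit Ω G q := by
  have hsymm : ∀ {x y : M}, (∃ (i : Fin n) (γ : ℝ → M) (T : ℝ),
      IsMIntegralCurveOn (I := 𝓘(ℝ, R2 n)) γ (hamVF Ω (component G i)) (uIcc 0 T) ∧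
        γ 0 = x ∧ γ T = y) → ∃ (i : Fin n) (γ : ℝ → M) (T : ℝ),
      IsMIntegralCurveOn (I := 𝓘(ℝ, R2 n)) γ (hamVF Ω (component G i)) (uIcc 0 T) ∧
        γ 0 = y ∧ γ T = x := by
    rintro x y ⟨i, γ, T, hγ, h0, hT⟩
    refine ⟨i, fun t => γ (t + T), -T, ?_, by simpa using hT, by simpa using h0⟩
    refine (hγ.comp_add T).mono fun t ht => ?_
    change t + T ∈ uIcc 0 T
    rw [mem_uIcc] at ht ⊢
    rcases ht with ht | ht
    · right; constructor <;> linarith [ht.1, ht.2]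
    · left; constructor <;> linarith [ht.1, ht.2]
  induction h with
  | refl => exact Relation.ReflTransGen.refl
  | tail _ hstep ih => exact Relation.ReflTransGen.head (hsymm hstep) ih

omit [NeZero n] in
theorem hamOrbit_trans {G : M → Fin n → ℝ} {p q r : M} (h : q ∈ hamOrbit Ω G p)
    (h' : r ∈ hamOrbit Ω G q) : r ∈ hamOrbit Ω G p :=
  Relation.ReflTransGen.trans h h'

/-- Since `a 0 ≠ 0`, the vector `a` and the remaining unit vectors form a basis. A small `s` is
reached by moving along one basis direction at a time. -/
theorem eventually_flat_mem_hamOrbit (hF : IsIntegrableSystem Ω F) {a : Fin n → ℝ} (ha : a 0 ≠ 0)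
    {Φ : (Fin n → ℝ) → M} {ρ : ℝ} (hρ : 0 < ρ) (hΦ : IsFlat Ω F Φ (Metric.ball 0 ρ)) :
    ∀ᶠ s in 𝓝 (0 : Fin n → ℝ), Φ s ∈ hamOrbit Ω (replaceFirst F a) (Φ 0) := by
  set b : Fin n → Fin n → ℝ := fun i => if i = 0 then a else Pi.single i 1 with hb
  have hVF : ∀ i, hamVF Ω (component (replaceFirst F a) i) = combVF Ω F (b i) := by
    intro i
    by_cases hi : i = 0
    · subst hi
      simp [hb, hamVF_replaceFirst_zero hF]
    · simp [hb, hi, hamVF_replaceFirst_of_ne hi]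
  -- The coordinates of `s` in the basis `b`.
  set c : Fin n → (Fin n → ℝ) → ℝ := fun i s => if i = 0 then s 0 / a 0 else s i - s 0 / a 0 * a i
    with hc
  have hcc : ∀ i, Continuous (c i) := by
    intro i
    simp only [hc]
    split_ifs <;> fun_prop
  have hsum : ∀ s, ∑ i, c i s • b i = s := by
    intro s
    funext j
    rw [Finset.sum_apply, ← Finset.add_sum_erase _ _ (Finset.mem_univ 0)]
    have h1 : ∀ i ∈ Finset.univ.erase (0 : Fin n), (c i s • b i) j
        = if i = j then c i s else 0 := by
      intro i hi
      have hi0 := Finset.ne_of_mem_erase hi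
      simp [hb, hi0, Pi.single_apply, eq_comm]
    rw [Finset.sum_congr rfl h1, Finset.sum_ite_eq']
    by_cases hj : j = 0
    · subst hj
      simp [hc, hb, ha]
    · simp [hc, hb, hj]
  have hev : ∀ᶠ s in 𝓝 (0 : Fin n → ℝ), ∀ A : Finset (Fin n),
      ∑ i ∈ A, c i s • b i ∈ Metric.ball (0 : Fin n → ℝ) ρ := by
    rw [Filter.eventually_all]
    intro A
    have hcont : Continuous fun s => ∑ i ∈ A, c i s • b i :=
      continuous_finsetSum _ fun i _ => (hcc i).smul continuous_const
    refine hcont.continuousAt.eventually_mem (Metric.isOpen_ball.mem_nhds ?_)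
    have : ∀ i, c i 0 = 0 := fun i => by simp [hc]
    simp [this, hρ]
  filter_upwards [hev] with s hs
  have key : ∀ A : Finset (Fin n),
      Φ (∑ i ∈ A, c i s • b i) ∈ hamOrbit Ω (replaceFirst F a) (Φ 0) := by
    intro A
    induction A using Finset.induction_on with
    | empty =>
      rw [Finset.sum_empty]
      exact Relation.ReflTransGen.refl
    | insert i A hi ih =>
      have hx := hs A
      have hy := hs (insert i A)
      rw [Finset.sum_insert hi, add_comm] at hy ⊢
      refine Relation.ReflTransGen.tail ih
        ⟨i, fun t => Φ (∑ i ∈ A, c i s • b i + t • b i), c i s, ?_, by simp, rfl⟩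
      rw [hVF]
      refine hΦ.isMIntegralCurveOn _ _ fun t ht => ?_
      rw [← segment_eq_uIcc, segment_eq_image] at ht
      obtain ⟨θ, hθ, rfl⟩ := ht
      have := (convex_ball (0 : Fin n → ℝ) ρ).add_smul_mem hx hy hθ
      simpa [smul_smul] using this
  have := key Finset.univ
  rwa [hsum] at this

section Family

variable [T2Space M] [IsManifold 𝓘(ℝ, R2 n) ω M]

omit [NeZero n] in
/-- Flat maps with moving base point are, locally, translates of each other. -/
theorem exists_flat_translation (hF : IsIntegrableSystem Ω F) {p : ℝ → M} {I : Set ℝ}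
    (hp : ContinuousOn p I) {Φ : ℝ → (Fin n → ℝ) → M} {ρ : ℝ → ℝ} {ℓ : ℝ} (hℓ : 0 ≤ ℓ)
    (hρ : ∀ u ∈ I, ℓ < ρ u) (hΦ : ∀ u ∈ I, IsFlat Ω F (Φ u) (Metric.ball 0 (ρ u)))
    (hpreg : ∀ u ∈ I, p u ∈ regFibre F) (hΦ0 : ∀ u ∈ I, Φ u 0 = p u) {u₀ : ℝ} (hu₀ : u₀ ∈ I) :
    ∃ (v : ℝ → Fin n → ℝ), ∃ N ∈ 𝓝[I] u₀, N ⊆ I ∧ ContinuousOn v N ∧ v u₀ = 0 ∧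
      ∀ u ∈ N, ∀ s : Fin n → ℝ, ‖s‖ ≤ ℓ →
        v u + s ∈ Metric.ball 0 (ρ u₀) ∧ Φ u s = Φ u₀ (v u + s) := by
  -- The translation vector is the flat coordinate `T (p u)`. The margin `ρ u₀ - ℓ` keeps translated
  -- parameters of norm at most `ℓ` inside the domain of `Φ u₀`.
  obtain ⟨ε, hε, Φ', T, hΦ'0, hΦ', hT0, hT, hΦT⟩ := exists_flat_chart hF (hpreg u₀ hu₀)
  have hpc : Filter.Tendsto p (𝓝[I] u₀) (𝓝 (p u₀)) := hp u₀ hu₀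
  have hTp : Filter.Tendsto (fun u => T (p u)) (𝓝[I] u₀) (𝓝 0) := by
    have := hT.continuousAt.tendsto.comp hpc
    rwa [hT0] at this
  have hev : ∀ᶠ u in 𝓝[I] u₀, u ∈ I ∧ T (p u) ∈ Metric.ball 0 ε ∧ Φ' (T (p u)) = p u ∧
      ContinuousAt T (p u) ∧ ‖T (p u)‖ < ρ u₀ - ℓ := by
    filter_upwards [self_mem_nhdsWithin, hpc.eventually hΦT,
      hpc.eventually ((contMDiffAt_iff_contMDiffAt_nhds (by simp)).1 hT),
      hTp.norm.eventually_lt_const (u := ρ u₀ - ℓ) (by simpa using hρ u₀ hu₀)]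
      with u h1 h2 h3 h4
    exact ⟨h1, (h2 (hpreg u h1).1).1, (h2 (hpreg u h1).1).2, h3.continuousAt, h4⟩
  refine ⟨fun u => T (p u), _, hev, fun u hu => hu.1, fun u hu => ?_, hT0, fun u hu s hs => ?_⟩
  · exact hu.2.2.2.1.comp_continuousWithinAt ((hp u hu.1).mono fun u hu => hu.1)
  · obtain ⟨huI, hTε, hΦTu, -, hTρ⟩ := hu
    have hmem : ∀ s : Fin n → ℝ, ‖s‖ ≤ ℓ → T (p u) + s ∈ Metric.ball (0 : Fin n → ℝ) (ρ u₀) := by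
      intro s hs
      rw [mem_ball_zero_iff]
      linarith [norm_add_le (T (p u)) s]
    refine ⟨hmem s hs, ?_⟩
    have hρ0 : 0 < ρ u₀ := hℓ.trans_lt (hρ u₀ hu₀)
    have h1 : Φ u₀ (T (p u)) = p u := by
      have hZ : Convex ℝ (Metric.ball (0 : Fin n → ℝ) ε ∩ Metric.ball 0 (ρ u₀)) :=
        (convex_ball _ _).inter (convex_ball _ _)
      have := IsFlat.eqOn hF hZ (hΦ'.mono inter_subset_left)
        ((hΦ u₀ hu₀).mono inter_subset_right) (a := 0)
        ⟨Metric.mem_ball_self hε, Metric.mem_ball_self hρ0⟩ (by rw [hΦ'0, hΦ0 u₀ hu₀])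
        ⟨hTε, by simpa using hmem 0 (by simpa using hℓ)⟩
      rw [← this, hΦTu]
    have hZ : Convex ℝ (Metric.ball (0 : Fin n → ℝ) (ρ u) ∩
        {s | T (p u) + s ∈ Metric.ball (0 : Fin n → ℝ) (ρ u₀)}) :=
      (convex_ball _ _).inter
        ((convex_ball (0 : Fin n → ℝ) (ρ u₀)).translate_preimage_right (T (p u)))
    have hball : ∀ s : Fin n → ℝ, ‖s‖ ≤ ℓ → s ∈ Metric.ball (0 : Fin n → ℝ) (ρ u) := fun s hs =>
      mem_ball_zero_iff.2 (hs.trans_lt (hρ u huI))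
    exact IsFlat.eqOn hF hZ ((hΦ u huI).mono inter_subset_left)
      (((hΦ u₀ hu₀).comp_add (T (p u))).mono inter_subset_right) (a := 0)
      ⟨hball 0 (by simpa using hℓ), hmem 0 (by simpa using hℓ)⟩
      (by rw [hΦ0 u huI, add_zero, h1]) ⟨hball s hs, hmem s hs⟩

omit [NeZero n] in
/-- A period of a flat map is a translation symmetry. -/
theorem IsFlat.add_period (hF : IsIntegrableSystem Ω F) {Φ : (Fin n → ℝ) → M} {ρ : ℝ}
    (hΦ : IsFlat Ω F Φ (Metric.ball 0 ρ)) {w s s' : Fin n → ℝ} (h : Φ (s + w) = Φ s)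
    (hs : s ∈ Metric.ball 0 ρ) (hsw : s + w ∈ Metric.ball 0 ρ) (hs' : s' ∈ Metric.ball 0 ρ)
    (hsw' : s' + w ∈ Metric.ball 0 ρ) : Φ (s' + w) = Φ s' := by
  have hZ : Convex ℝ ({s | w + s ∈ Metric.ball (0 : Fin n → ℝ) ρ} ∩ Metric.ball 0 ρ) :=
    ((convex_ball (0 : Fin n → ℝ) ρ).translate_preimage_right w).inter (convex_ball _ _)
  rw [add_comm] at hsw hsw' h ⊢
  exact IsFlat.eqOn hF hZ ((hΦ.comp_add w).mono inter_subset_left)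
    (hΦ.mono inter_subset_right) ⟨hsw, hs⟩ h ⟨hsw', hs'⟩

omit [NeZero n] in
-- Near `u₀` every `Φ u` is a translate of `Φ u₀`, so `w` is a period at `u` exactly when it is one
-- at `u₀`. Connectedness of `I` propagates this.
theorem flat_period_of_path (hF : IsIntegrableSystem Ω F) {p : ℝ → M} {I : Set ℝ}
    (hI : IsPreconnected I)
    (hp : ContinuousOn p I) {Φ : ℝ → (Fin n → ℝ) → M} {ρ : ℝ → ℝ} {w : Fin n → ℝ}
    (hρ : ∀ u ∈ I, ‖w‖ < ρ u) (hΦ : ∀ u ∈ I, IsFlat Ω F (Φ u) (Metric.ball 0 (ρ u)))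
    (hpreg : ∀ u ∈ I, p u ∈ regFibre F) (hΦ0 : ∀ u ∈ I, Φ u 0 = p u) {u₁ : ℝ} (hu₁ : u₁ ∈ I)
    (h₁ : Φ u₁ w = p u₁) {u : ℝ} (hu : u ∈ I) : Φ u w = p u := by
  refine (hI.induction₂ (fun u u' => (Φ u w = p u) ↔ (Φ u' w = p u')) (fun u₀ hu₀ => ?_)
    (fun _ _ _ _ _ _ h h' => h.trans h') (fun _ _ _ _ h => h.symm) hu₁ hu).1 h₁
  obtain ⟨v, N, hN, hNI, -, -, hv⟩ :=
    exists_flat_translation hF hp (norm_nonneg w) hρ hΦ hpreg hΦ0 hu₀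
  filter_upwards [hN] with u hu
  obtain ⟨h1, h2⟩ := hv u hu w le_rfl
  obtain ⟨h3, h4⟩ := hv u hu 0 (by simp)
  rw [add_zero] at h3 h4
  rw [← hΦ0 u₀ hu₀, ← hΦ0 u (hNI hu), h2, h4]
  have h5 : (0 : Fin n → ℝ) ∈ Metric.ball (0 : Fin n → ℝ) (ρ u₀) :=
    Metric.mem_ball_self ((norm_nonneg w).trans_lt (hρ u₀ hu₀))
  have h6 : 0 + w ∈ Metric.ball (0 : Fin n → ℝ) (ρ u₀) := by
    rw [zero_add, mem_ball_zero_iff]; exact hρ u₀ hu₀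
  constructor
  · intro h
    exact (hΦ u₀ hu₀).add_period hF (s := 0) (by rwa [zero_add]) h5 h6 h3 h1
  · intro h
    have := (hΦ u₀ hu₀).add_period hF (s := v u) h h3 h1 h5 h6
    rwa [zero_add] at this

end Family

end Periodic

/-! ### The continuous family of periodic trajectories. -/

section PeriodicFamily

variable {n : ℕ} {M : Type*} [TopologicalSpace M] [ChartedSpace (R2 n) M]
  {Ω : SymplecticForm n M} {F : M → Fin n → ℝ} [T2Space M] [IsManifold 𝓘(ℝ, R2 n) ω M]

/-- The `2π`-periodic extension of `t ↦ Φ(ta)`, `0 ≤ t < 2π`. -/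
noncomputable def wrapLine (Φ : (Fin n → ℝ) → M) (a : Fin n → ℝ) (t : ℝ) : M :=
  Φ (toIcoMod Real.two_pi_pos 0 t • a)

omit [TopologicalSpace M] [ChartedSpace (R2 n) M] [T2Space M] [IsManifold 𝓘(ℝ, R2 n) ω M] in
theorem wrapLine_periodic (Φ : (Fin n → ℝ) → M) (a : Fin n → ℝ) :
    Function.Periodic (wrapLine Φ a) (2 * Real.pi) := fun t => by
  rw [wrapLine, toIcoMod_add_right, wrapLine]

/-- The open interval `(-2π, 2π)` is larger than the fundamental domain, so every time, multiples of
`2π` included, is interior to it for a suitable shift `k`. Smoothness and continuity across the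
seams follow from this. -/
theorem wrapLine_eq (hF : IsIntegrableSystem Ω F) {Φ : (Fin n → ℝ) → M} {ρ : ℝ}
    {a : Fin n → ℝ} (hΦ : IsFlat Ω F Φ (Metric.ball 0 ρ)) (hρ : ‖(2 * Real.pi) • a‖ < ρ)
    (hper : Φ ((2 * Real.pi) • a) = Φ 0) {t : ℝ} {k : ℤ}
    (ht : t - k • (2 * Real.pi) ∈ Ioo (-(2 * Real.pi)) (2 * Real.pi)) :
    wrapLine Φ a t = Φ ((t - k • (2 * Real.pi)) • a) := by
  set s := t - k • (2 * Real.pi) with hs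
  have hmod : toIcoMod Real.two_pi_pos 0 t = toIcoMod Real.two_pi_pos 0 s := by
    rw [hs, toIcoMod_sub_zsmul]
  have hball : ∀ x : ℝ, |x| ≤ 2 * Real.pi → x • a ∈ Metric.ball (0 : Fin n → ℝ) ρ := fun x hx => by
    rw [mem_ball_zero_iff]
    refine lt_of_le_of_lt ?_ hρ
    rw [norm_smul, norm_smul, Real.norm_eq_abs, Real.norm_of_nonneg Real.two_pi_pos.le]
    gcongr
  rw [wrapLine, hmod]
  rcases le_or_gt 0 s with h | h
  · rw [(toIcoMod_eq_self Real.two_pi_pos).2 ⟨h, by simpa using ht.2⟩]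
  · have h2 : toIcoMod Real.two_pi_pos 0 s = s + 2 * Real.pi := by
      rw [← toIcoMod_add_right]
      exact (toIcoMod_eq_self Real.two_pi_pos).2 ⟨by linarith [ht.1], by linarith⟩
    rw [h2, add_smul]
    refine hΦ.add_period hF (s := 0) (by rwa [zero_add]) (by simpa using hball 0 (by simp [Real.pi_nonneg]))
      (by rw [zero_add]; exact hball _ (abs_of_pos Real.two_pi_pos).le)
      (hball s (abs_le.2 ⟨ht.1.le, ht.2.le⟩)) ?_
    rw [← add_smul]
    exact hball _ (abs_le.2 ⟨by linarith [ht.1], by linarith⟩)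

theorem wrapLine_isMIntegralCurve (hF : IsIntegrableSystem Ω F) {Φ : (Fin n → ℝ) → M} {ρ : ℝ}
    {a : Fin n → ℝ} (hΦ : IsFlat Ω F Φ (Metric.ball 0 ρ)) (hρ : ‖(2 * Real.pi) • a‖ < ρ)
    (hper : Φ ((2 * Real.pi) • a) = Φ 0) :
    IsMIntegralCurve (I := 𝓘(ℝ, R2 n)) (wrapLine Φ a) (combVF Ω F a) := by
  intro t₀
  set k := toIcoDiv Real.two_pi_pos 0 t₀
  set S : Set ℝ := {t | t - k • (2 * Real.pi) ∈ Ioo (-(2 * Real.pi)) (2 * Real.pi)} with hS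
  have hSo : IsOpen S := isOpen_Ioo.preimage (by fun_prop)
  have ht₀ : t₀ ∈ S := by
    have := toIcoMod_mem_Ico Real.two_pi_pos 0 t₀
    change toIcoMod Real.two_pi_pos 0 t₀ ∈ Ioo (-(2 * Real.pi)) (2 * Real.pi)
    exact ⟨by linarith [this.1, Real.two_pi_pos], by simpa using this.2⟩
  have hline := hΦ.isMIntegralCurveOn (-(k • (2 * Real.pi)) • a) a (S := S) fun t ht => by
    rw [← add_smul, neg_add_eq_sub, mem_ball_zero_iff]
    refine lt_of_le_of_lt ?_ hρ
    rw [norm_smul, norm_smul, Real.norm_eq_abs, Real.norm_of_nonneg Real.two_pi_pos.le]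
    gcongr
    exact abs_le.2 ⟨ht.1.le, ht.2.le⟩
  have hev : wrapLine Φ a =ᶠ[𝓝 t₀] fun t => Φ (-(k • (2 * Real.pi)) • a + t • a) := by
    filter_upwards [hSo.mem_nhds ht₀] with t ht
    rw [wrapLine_eq hF hΦ hρ hper ht, ← add_smul, neg_add_eq_sub]
  have h := ((hline t₀ ht₀).hasMFDerivAt (hSo.mem_nhds ht₀)).congr_of_eventuallyEq hev
  rw [hev.eq_of_nhds]
  exact h

/-- A path of base points with flat maps sharing a period yields a family of periodic
trajectories. -/
theorem periodicityCondition_of_path [NeZero n] (hF : IsIntegrableSystem Ω F) {m₀ m₁ : M}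
    (hrank : rankAt F m₀ = 0) {p : ℝ → M} (hp : ContinuousOn p (Ioc 0 1))
    {Φ : ℝ → (Fin n → ℝ) → M} {ρ : ℝ → ℝ} {w : Fin n → ℝ} (hw : w 0 ≠ 0)
    (hρ : ∀ u ∈ Ioc (0 : ℝ) 1, ‖w‖ < ρ u)
    (hΦ : ∀ u ∈ Ioc (0 : ℝ) 1, IsFlat Ω F (Φ u) (Metric.ball 0 (ρ u)))
    (hpreg : ∀ u ∈ Ioc (0 : ℝ) 1, p u ∈ regFibre F) (hΦ0 : ∀ u ∈ Ioc (0 : ℝ) 1, Φ u 0 = p u)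
    (hp1 : p 1 = m₁) (hper : Φ 1 w = m₁) (hm₀ : m₀ ∈ closure (p '' Ioc 0 1)) :
    ∃ a : Fin n → ℝ, a 0 ≠ 0 ∧ PeriodicityCondition Ω (replaceFirst F a) m₀ m₁ := by
  have h1 : (1 : ℝ) ∈ Ioc (0 : ℝ) 1 := ⟨zero_lt_one, le_rfl⟩
  have hperu : ∀ u ∈ Ioc (0 : ℝ) 1, Φ u w = Φ u 0 := fun u hu => by
    rw [hΦ0 u hu]
    exact flat_period_of_path hF isPreconnected_Ioc hp hρ hΦ hpreg hΦ0 h1 (by rw [hper, hp1]) hu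
  -- Dividing by `2π` normalizes the period of `X_f`.
  obtain ⟨a, haw, ha0⟩ : ∃ a : Fin n → ℝ, (2 * Real.pi) • a = w ∧ a 0 ≠ 0 :=
    ⟨(2 * Real.pi)⁻¹ • w, smul_inv_smul₀ Real.two_pi_pos.ne' w,
      mul_ne_zero (inv_ne_zero Real.two_pi_pos.ne') hw⟩
  rw [← haw] at hρ hperu
  have hΓ0 : ∀ u ∈ Ioc (0 : ℝ) 1, wrapLine (Φ u) a 0 = p u := fun u hu => by
    have := wrapLine_eq hF (hΦ u hu) (hρ u hu) (hperu u hu) (t := 0) (k := 0)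
      (by simp [Real.pi_pos])
    rw [this, ← hΦ0 u hu]
    simp
  have hint : ∀ u ∈ Ioc (0 : ℝ) 1, IsMIntegralCurve (I := 𝓘(ℝ, R2 n)) (wrapLine (Φ u) a)
      (hamVF Ω (component (replaceFirst F a) 0)) := fun u hu => by
    rw [hamVF_replaceFirst_zero hF]
    exact wrapLine_isMIntegralCurve hF (hΦ u hu) (hρ u hu) (hperu u hu)
  refine ⟨a, ha0, fun _ => m₀, fun u => wrapLine (Φ u) a, ?_, ⟨1, one_pos, fun _ => rfl⟩, ?_,
    fun u hu => ⟨hint u hu, wrapLine_periodic _ _, ?_⟩, ⟨0, (hΓ0 1 h1).trans hp1⟩, ⟨0, rfl⟩, ?_⟩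
  · refine isMIntegralCurve_const ?_
    rw [hamVF_replaceFirst_zero hF]
    exact hamFrame_eq_zero_of_rankAt (hF.mdifferentiableAt m₀) hrank a
  -- Joint continuity: near `(u₀, t₀)` the whole family is the single flat map `Φ u₀` applied to a
  -- continuous parameter.
  · rintro ⟨u₀, t₀⟩ ⟨hu₀, -⟩
    obtain ⟨v, N, hN, hNI, hvc, hv0, hv⟩ :=
      exists_flat_translation hF hp (norm_nonneg _) hρ hΦ hpreg hΦ0 hu₀
    have hu₀N : u₀ ∈ N := mem_of_mem_nhdsWithin hu₀ hN
    set k := toIcoDiv Real.two_pi_pos 0 t₀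
    set S : Set ℝ := {t | t - k • (2 * Real.pi) ∈ Ioo (-(2 * Real.pi)) (2 * Real.pi)} with hS
    have hSo : IsOpen S := isOpen_Ioo.preimage (by fun_prop)
    have ht₀ : t₀ ∈ S := by
      have := toIcoMod_mem_Ico Real.two_pi_pos 0 t₀
      change toIcoMod Real.two_pi_pos 0 t₀ ∈ Ioo (-(2 * Real.pi)) (2 * Real.pi)
      exact ⟨by linarith [this.1, Real.two_pi_pos], by simpa using this.2⟩
    have hnorm : ∀ t ∈ S, ‖(t - k • (2 * Real.pi)) • a‖ ≤ ‖(2 * Real.pi) • a‖ := fun t ht => by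
      rw [norm_smul, norm_smul, Real.norm_eq_abs, Real.norm_of_nonneg Real.two_pi_pos.le]
      gcongr
      exact abs_le.2 ⟨ht.1.le, ht.2.le⟩
    have heq : ∀ q ∈ N ×ˢ S, wrapLine (Φ q.1) a q.2
        = Φ u₀ (v q.1 + (q.2 - k • (2 * Real.pi)) • a) := fun q hq => by
      rw [wrapLine_eq hF (hΦ _ (hNI hq.1)) (hρ _ (hNI hq.1)) (hperu _ (hNI hq.1)) hq.2]
      exact (hv q.1 hq.1 _ (hnorm _ hq.2)).2
    have hnhds : N ×ˢ S ∈ 𝓝[Ioc (0 : ℝ) 1 ×ˢ univ] (u₀, t₀) := by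
      rw [nhdsWithin_prod_eq, nhdsWithin_univ]
      exact Filter.prod_mem_prod hN (hSo.mem_nhds ht₀)
    refine ContinuousWithinAt.mono_of_mem_nhdsWithin ?_ hnhds
    refine ContinuousWithinAt.congr ?_ heq (heq (u₀, t₀) ⟨hu₀N, ht₀⟩)
    have hin : ContinuousWithinAt (fun q : ℝ × ℝ => v q.1 + (q.2 - k • (2 * Real.pi)) • a)
        (N ×ˢ S) (u₀, t₀) := by
      refine ContinuousWithinAt.add ?_ (by fun_prop)
      exact (hvc u₀ hu₀N).comp continuous_fst.continuousWithinAt fun q hq => hq.1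
    exact ((hΦ u₀ hu₀).continuousAt (hv u₀ hu₀N _ (hnorm _ ht₀)).1).comp_continuousWithinAt
      (f := fun q : ℝ × ℝ => v q.1 + (q.2 - k • (2 * Real.pi)) • a) (x := (u₀, t₀)) hin
  -- Nearby points of the path differ by a small flat displacement, hence share an orbit;
  -- connectedness extends this to the whole path.
  · have hpu : p u ∈ hamOrbit Ω (replaceFirst F a) m₁ := by
      rw [← hp1]
      refine (isPreconnected_Ioc (a := (0 : ℝ)) (b := 1)).induction₂
        (fun u u' => p u' ∈ hamOrbit Ω (replaceFirst F a) (p u)) (fun u₀ hu₀ => ?_)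
        (fun _ _ _ _ _ _ h h' => hamOrbit_trans h h') (fun _ _ _ _ h => hamOrbit_symm h) h1 hu
      obtain ⟨v, N, hN, hNI, hvc, hv0, hv⟩ :=
        exists_flat_translation hF hp (norm_nonneg _) hρ hΦ hpreg hΦ0 hu₀
      have hu₀N : u₀ ∈ N := mem_of_mem_nhdsWithin hu₀ hN
      have hvt : Filter.Tendsto v (𝓝[Ioc 0 1] u₀) (𝓝 0) := by
        have := (hvc u₀ hu₀N).mono_of_mem_nhdsWithin hN
        rwa [ContinuousWithinAt, hv0] at this
      filter_upwards [hN, hvt.eventually (eventually_flat_mem_hamOrbit hF ha0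
        ((norm_nonneg _).trans_lt (hρ u₀ hu₀)) (hΦ u₀ hu₀))] with u huN hu
      rw [← hΦ0 u₀ hu₀, ← hΦ0 u (hNI huN), (hv u huN 0 (by simp)).2, add_zero]
      exact hu
    rintro _ ⟨t, rfl⟩
    exact Relation.ReflTransGen.tail hpu
      ⟨0, wrapLine (Φ u) a, t, (hint u hu).isMIntegralCurveOn _, hΓ0 u hu, rfl⟩
  · rintro _ ⟨_, rfl⟩
    refine closure_mono ?_ hm₀
    rintro _ ⟨u, hu, rfl⟩
    exact mem_biUnion hu ⟨0, hΓ0 u hu⟩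

end PeriodicFamily

/-! ### Growth estimates and large flat maps in a canonical chart. -/

section CanonicalChart

variable {n : ℕ} {M : Type*} [TopologicalSpace M] [ChartedSpace (R2 n) M]
  {Ω : SymplecticForm n M} {F : M → Fin n → ℝ}

theorem sum_even_add_odd (g : Fin (2 * n) → ℝ) :
    ∑ k, g k = ∑ i : Fin n, (g ⟨2 * i, by omega⟩ + g ⟨2 * i + 1, by omega⟩) := by
  rw [← (finProdFinEquiv.trans (finCongr (mul_comm n 2))).sum_comp, Fintype.sum_prod_type]
  refine Finset.sum_congr rfl fun i _ => ?_
  rw [Fin.sum_univ_two]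
  congr 2
  · ext
    simp
  · ext
    simp [add_comm]

/-- The witness is `X` rotated by the standard complex structure, up to sign. Pairing with it shows
that a Hamiltonian field is no longer than its differential. -/
theorem exists_stdSymplectic_eq_sq (X : R2 n) :
    ∃ w : R2 n, ‖w‖ = ‖X‖ ∧ stdSymplectic w X = ‖X‖ ^ 2 := by
  let w : R2 n := WithLp.toLp 2 fun k => if h : (k : ℕ) % 2 = 0
    then X ⟨k + 1, by omega⟩ else -X ⟨k - 1, by omega⟩
  have h0 : ∀ i : Fin n, w ⟨2 * i, by omega⟩ = X ⟨2 * i + 1, by omega⟩ := fun i => by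
    simp [w]
  have h1 : ∀ i : Fin n, w ⟨2 * i + 1, by omega⟩ = -X ⟨2 * i, by omega⟩ := fun i => by
    simp [w, Nat.add_mod]
  have hX : ‖X‖ ^ 2 = ∑ i : Fin n, (X ⟨2 * i, by omega⟩ ^ 2 + X ⟨2 * i + 1, by omega⟩ ^ 2) := by
    rw [EuclideanSpace.real_norm_sq_eq, sum_even_add_odd]
  refine ⟨w, ?_, ?_⟩
  · rw [← sq_eq_sq₀ (norm_nonneg _) (norm_nonneg _), hX, EuclideanSpace.real_norm_sq_eq,
      sum_even_add_odd]
    exact Finset.sum_congr rfl fun i _ => by rw [h0, h1]; ring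
  · rw [hX, stdSymplectic]
    exact Finset.sum_congr rfl fun i _ => by rw [h0, h1]; ring

variable {m₀ : M} {r c : ℝ} {φ : OpenPartialHomeomorph M (R2 n)}

/-- The factor `n` comes from the sup norm on `v`: `∑ |vᵢ| ≤ n ‖v‖`. -/
theorem norm_localFrame_le (hF : IsIntegrableSystem Ω F) (hφ : IsCanonicalChart Ω m₀ r φ)
    (hc : 0 ≤ c) {x : R2 n} (hx : x ∈ φ.target)
    (hbd : ∀ i, ‖fderiv ℝ (fun y => component F i (φ.symm y)) x‖ ≤ c * ‖x‖) :
    ‖localFrame Ω F φ x‖ ≤ n * c * ‖x‖ := by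
  refine ContinuousLinearMap.opNorm_le_bound _ (by positivity) fun v => ?_
  obtain ⟨w, hw, hwX⟩ := exists_stdSymplectic_eq_sq (localFrame Ω F φ x v)
  have h := pullbackForm_localFrame hF hφ.isSymplecticChart hx v w
  have hsum : fderiv ℝ (fun y => ∑ i, v i * F (φ.symm y) i) x
      = ∑ i, v i • fderiv ℝ (fun y => component F i (φ.symm y)) x := by
    refine HasFDerivAt.fderiv ?_
    refine HasFDerivAt.fun_sum fun i _ => ?_
    refine HasFDerivAt.const_mul ?_ (v i)
    have h1 := (contDiffOn_combination hF hφ.isSymplecticChart (Pi.single i 1)).contDiffAt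
      (φ.open_target.mem_nhds hx)
    have h2 : (fun y => ∑ j, (Pi.single i 1 : Fin n → ℝ) j * F (φ.symm y) j)
        = fun y => component F i (φ.symm y) := by
      funext y
      simp [Pi.single_apply, component]
    rw [h2] at h1
    exact (h1.differentiableAt (by simp)).hasFDerivAt
  rw [hφ.pullbackForm_eq hx, hsum] at h
  change stdSymplectic w (localFrame Ω F φ x v) = _ at h
  rw [hwX] at h
  have hle : ‖localFrame Ω F φ x v‖ ^ 2 ≤ n * c * ‖x‖ * ‖v‖ * ‖localFrame Ω F φ x v‖ := by
    rw [h]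
    refine (Real.le_norm_self _).trans ((ContinuousLinearMap.le_opNorm _ w).trans ?_)
    rw [hw]
    gcongr
    refine (norm_sum_le_of_le _ fun i _ => ?_).trans (b := ∑ _i : Fin n, ‖v‖ * (c * ‖x‖)) ?_
    · rw [norm_smul]
      exact mul_le_mul (norm_le_pi_norm v i) (hbd i) (norm_nonneg _) (norm_nonneg _)
    · rw [Finset.sum_const, Finset.card_univ, Fintype.card_fin, nsmul_eq_mul]
      exact le_of_eq (by ring)
  rcases (norm_nonneg (localFrame Ω F φ x v)).eq_or_lt with h0 | h0
  · rw [← h0]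
    positivity
  · rw [pow_two] at hle
    exact le_of_mul_le_mul_right hle h0

/-- In a canonical chart with linear growth of the differentials, flat maps exist on large
balls. -/
theorem IsCanonicalChart.exists_isFlat (hF : IsIntegrableSystem Ω F)
    (hφ : IsCanonicalChart Ω m₀ r φ) (hc : 0 ≤ c)
    (hbd : ∀ x ∈ Metric.ball (0 : R2 n) r, ∀ i : Fin n,
      ‖fderiv ℝ (fun y => component F i (φ.symm y)) x‖ ≤ c * ‖x‖)
    {q : M} (hq : q ∈ φ.source) {ρ : ℝ} (hρ : 0 < ρ) (hqρ : ‖φ q‖ * Real.exp (n * c * ρ) < r) :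
    ∃ Φ, Φ 0 = q ∧ IsFlat Ω F Φ (Metric.ball 0 ρ) := by
  have he := hφ.isSymplecticChart
  have ht : ∀ x ∈ Metric.ball (0 : R2 n) r, x ∈ φ.target := fun x hx => hφ.target_eq ▸ hx
  -- Here the growth is purely linear, so `α = 0` and the radius condition becomes `‖φ q‖ exp (ncρ)
  -- < r`.
  obtain ⟨Ψ, hΨ0, hΨ⟩ := exists_timeOne_of_commuting (A := localFrame Ω F φ) (c := 0)
    (x₀ := φ q) (R := r) (α := 0) (κ := n * c) (by positivity) le_rfl
    (((contDiffOn_localFrame hF he).mono ht).of_le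
      (WithTop.coe_le_coe.2 (le_top : (2 : ℕ∞) ≤ ⊤)))
    (fun x hx v w => localFrame_commute hF he (ht x hx) v w)
    (fun x hx => by simpa using norm_localFrame_le hF hφ hc (ht x hx) (hbd x hx)) hρ
    (by simpa using hqρ)
  exact ⟨fun s => φ.symm (Ψ s), by simp [hΨ0, φ.left_inv hq], fun s hs =>
    hasMFDerivAt_symm_comp he (ht _ (hΨ s hs).1) (hΨ s hs).2⟩

end CanonicalChart

/-! ### Globally defined flat maps for complete flows. -/

section CompleteFlows

variable {n : ℕ} {M : Type*} [TopologicalSpace M] [ChartedSpace (R2 n) M]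
  {Ω : SymplecticForm n M} {F : M → Fin n → ℝ} [T2Space M] [IsManifold 𝓘(ℝ, R2 n) ω M]

/-- The flow of `X_v` maps flat maps to flat maps. -/
theorem IsFlat.transport (hF : IsIntegrableSystem Ω F) {Φ : (Fin n → ℝ) → M}
    {Z : Set (Fin n → ℝ)} (hZ : IsOpen Z) (h : IsFlat Ω F Φ Z) {v : Fin n → ℝ}
    {g : ℝ → (Fin n → ℝ) → M}
    (hg : ∀ s ∈ Z, IsMIntegralCurve (I := 𝓘(ℝ, R2 n)) (fun t => g t s) (combVF Ω F v))
    (hg0 : ∀ s ∈ Z, g 0 s = Φ s) (t : ℝ) : IsFlat Ω F (g t) Z := by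
  intro s₀ hs₀
  -- Flatness is required near `s₀`, not just at it, because the propagation compares flat maps on a
  -- whole ball.
  set Q : ℝ → Prop := fun t => ∀ᶠ s in 𝓝 s₀,
    HasMFDerivAt 𝓘(ℝ, Fin n → ℝ) 𝓘(ℝ, R2 n) (g t) s (hamFrame Ω F (g t s)) with hQ
  suffices Q 0 ↔ Q t by
    have h0 : Q 0 := by
      filter_upwards [hZ.eventually_mem hs₀] with s hs
      exact IsFlat.congr_of_eventuallyEq (h s hs)
        (by filter_upwards [hZ.eventually_mem hs] with s hs using hg0 s hs)
    exact (this.1 h0).self_of_nhds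
  refine isPreconnected_univ.induction₂ (fun t t' => Q t ↔ Q t') (fun t₀ _ => ?_)
    (fun _ _ _ _ _ _ h h' => h.trans h') (fun _ _ _ _ h => h.symm) (mem_univ _) (mem_univ _)
  obtain ⟨ε, hε, ψ, hψ0, hψ⟩ := exists_isFlat_ball hF (g t₀ s₀)
  have key : ∀ t₁ t₂ : ℝ, (t₁ - t₀) • v ∈ Metric.ball (0 : Fin n → ℝ) ε →
      (t₂ - t₀) • v ∈ Metric.ball (0 : Fin n → ℝ) ε → Q t₁ → Q t₂ := by
    intro t₁ t₂ h₁ h₂ hQ₁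
    have hcurve : ∀ s ∈ Z, ∀ a b : ℝ, ∀ x ∈ Metric.ball (0 : Fin n → ℝ) ε,
        x + (b - a) • v ∈ Metric.ball (0 : Fin n → ℝ) ε → g a s = ψ x →
        g b s = ψ (x + (b - a) • v) := fun s hs a b x hx hx' hax => by
      have := hψ.eq_integralCurve hF (convex_ball _ _) (η := fun t => g (t + a) s) (T := b - a)
        (((hg s hs).comp_add a).isMIntegralCurveOn _) (by simpa using hax) hx hx'
      simpa using this
    have hs₀₁ : g t₁ s₀ = ψ ((t₁ - t₀) • v) := by
      have := hcurve s₀ hs₀ t₀ t₁ 0 (Metric.mem_ball_self hε) (by rwa [zero_add]) hψ0.symm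
      rwa [zero_add] at this
    obtain ⟨δ, hδ, hball⟩ := Metric.eventually_nhds_iff_ball.1 hQ₁
    -- Near `(t₀, s₀)` the transported map is to be identified with `ψ ((t - t₀) • v + (s - s₀))`.
    set a : ℝ → Fin n → ℝ := fun t => (t - t₀) • v - s₀ with ha
    have hconv : Convex ℝ (Metric.ball s₀ δ ∩ {s | a t₁ + s ∈ Metric.ball (0 : Fin n → ℝ) ε}) :=
      (convex_ball _ _).inter ((convex_ball (0 : Fin n → ℝ) ε).translate_preimage_right (a t₁))
    have heq := IsFlat.eqOn hF hconv (IsFlat.mono (Ω := Ω) (F := F) (Φ := g t₁)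
      (Z := Metric.ball s₀ δ) hball inter_subset_left)
      ((hψ.comp_add (a t₁)).mono inter_subset_right) (a := s₀)
      ⟨Metric.mem_ball_self hδ, by simpa [ha] using h₁⟩ (by simpa [ha] using hs₀₁)
    have hopen : ∀ t, (t - t₀) • v ∈ Metric.ball (0 : Fin n → ℝ) ε →
        ∀ᶠ s in 𝓝 s₀, a t + s ∈ Metric.ball (0 : Fin n → ℝ) ε := fun t ht =>
      (by fun_prop : ContinuousAt (fun s => a t + s) s₀).eventually_mem
        (Metric.isOpen_ball.mem_nhds (by simpa [ha] using ht))
    have hev : ∀ᶠ s in 𝓝 s₀, g t₂ s = ψ (a t₂ + s) := by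
      filter_upwards [hZ.eventually_mem hs₀, Metric.ball_mem_nhds s₀ hδ, hopen t₁ h₁,
        hopen t₂ h₂] with s hsZ hsδ hs₁ hs₂
      have h3 : a t₁ + s + (t₂ - t₁) • v = a t₂ + s := by
        simp only [ha]
        module
      have := hcurve s hsZ t₁ t₂ (a t₁ + s) hs₁ (by rwa [h3]) (heq ⟨hsδ, hs₁⟩)
      rwa [h3] at this
    filter_upwards [hev.eventually_nhds, hopen t₂ h₂] with s hs hs₂
    exact IsFlat.congr_of_eventuallyEq (hψ.comp_add (a t₂) s hs₂) hs
  have hnear : ∀ᶠ t in 𝓝 t₀, (t - t₀) • v ∈ Metric.ball (0 : Fin n → ℝ) ε :=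
    (by fun_prop : ContinuousAt (fun t => (t - t₀) • v) t₀).eventually_mem
      (Metric.isOpen_ball.mem_nhds (by simpa using hε))
  rw [nhdsWithin_univ]
  filter_upwards [hnear] with t ht
  exact ⟨key t₀ t hnear.self_of_nhds ht, key t t₀ ht hnear.self_of_nhds⟩

/-- If the flows are complete in the zero fibre, then every point of it lies on a globally
defined flat map. -/
theorem FlowsCompleteInZeroFibre.exists_isFlat_univ (hF : IsIntegrableSystem Ω F)
    (hcomp : FlowsCompleteInZeroFibre Ω F) {p : M} (hp : F p = 0) :
    ∃ Φ, Φ 0 = p ∧ IsFlat Ω F Φ univ := by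
  obtain ⟨ε, hε, Φ₀, hΦ₀0, hΦ₀⟩ := exists_isFlat_ball hF p
  -- Coordinates in `A` are unrestricted, the others lie in `(-ε, ε)`. Each induction step frees one
  -- more coordinate by means of the complete flow of `X_{f_k}`.
  set Z : Finset (Fin n) → Set (Fin n → ℝ) := fun A =>
    Set.pi (A : Set (Fin n))ᶜ fun _ => Metric.ball (0 : ℝ) ε with hZdef
  have hZo : ∀ A, IsOpen (Z A) := fun A =>
    isOpen_set_pi (Set.toFinite _) fun _ _ => Metric.isOpen_ball
  have hZc : ∀ A, Convex ℝ (Z A) := fun A => convex_pi fun _ _ => convex_ball _ _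
  have hZ0 : ∀ A, (0 : Fin n → ℝ) ∈ Z A := fun A i _ => Metric.mem_ball_self hε
  suffices ∀ A, ∃ Φ, Φ 0 = p ∧ IsFlat Ω F Φ (Z A) by
    obtain ⟨Φ, h0, hΦ⟩ := this Finset.univ
    exact ⟨Φ, h0, hΦ.mono fun s _ i hi => absurd (Finset.mem_coe.2 (Finset.mem_univ i)) hi⟩
  intro A
  induction A using Finset.induction_on with
  | empty =>
    refine ⟨Φ₀, hΦ₀0, hΦ₀.mono fun s hs => ?_⟩
    rw [mem_ball_zero_iff, pi_norm_lt_iff hε]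
    exact fun i => mem_ball_zero_iff.1 (hs i (by simp))
  | insert k A hk ih =>
    obtain ⟨Φ, h0, hΦ⟩ := ih
    have hL : ∀ s ∈ Z A, Φ s ∈ F ⁻¹' {0} := fun s hs => by
      rw [mem_preimage, hΦ.momentum_eq hF (hZc A) (hZ0 A) hs, h0, hp, mem_singleton_iff]
    choose! η hη hη0 using hcomp k
    set g : ℝ → (Fin n → ℝ) → M := fun t s => η (Φ s) t with hgdef
    have hVF : hamVF Ω (component F k) = combVF Ω F (Pi.single k 1) :=
      funext fun m => (hamFrame_single m k).symm
    have hg : ∀ s ∈ Z A, IsMIntegralCurve (I := 𝓘(ℝ, R2 n)) (fun t => g t s)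
        (combVF Ω F (Pi.single k 1)) := fun s hs => by
      rw [← hVF]
      exact hη (Φ s) (hL s hs)
    have hflat := IsFlat.transport hF (hZo A) hΦ hg fun s hs => hη0 (Φ s) (hL s hs)
    -- The `k`-th coordinate is used as flow time, applied to the point with that coordinate set to
    -- zero. Near `s₀` this is a translate of the flat map `g (s₀ k)`, hence flat.
    refine ⟨fun s => g (s k) (Function.update s k 0), ?_, fun s₀ hs₀ => ?_⟩
    · change g 0 (Function.update 0 k 0) = p
      rw [(Function.update_eq_self_iff.2 rfl : Function.update (0 : Fin n → ℝ) k 0 = 0)]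
      exact (hη0 (Φ 0) (hL 0 (hZ0 A))).trans h0
    · have hupd : ∀ s ∈ Z (insert k A), ∀ x ∈ Metric.ball (0 : ℝ) ε,
          Function.update s k x ∈ Z A := fun s hs x hx i hi => by
        by_cases hik : i = k
        · subst hik
          simpa using hx
        · rw [Function.update_of_ne hik]
          refine hs i ?_
          simpa [hik] using hi
      have htr : ∀ s : Fin n → ℝ, -(s₀ k • Pi.single k 1) + s
          = Function.update s k (s k - s₀ k) := fun s => by
        funext i
        by_cases hik : i = k
        · subst hik
          simp [neg_add_eq_sub]
        · simp [hik]
      have hev : ∀ᶠ s in 𝓝 s₀, s ∈ Z (insert k A) ∧ s k - s₀ k ∈ Metric.ball (0 : ℝ) ε :=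
        ((hZo _).eventually_mem hs₀).and
          (((continuous_apply k).sub continuous_const).continuousAt.eventually_mem
            (Metric.isOpen_ball.mem_nhds (by simpa using hε)))
      have heq : ∀ᶠ s in 𝓝 s₀, g (s k) (Function.update s k 0)
          = g (s₀ k) (-(s₀ k • Pi.single k 1) + s) := by
        filter_upwards [hev] with s hs
        have h1 := hupd s hs.1 0 (Metric.mem_ball_self hε)
        have h2 : Function.update s k 0 + (s k - s₀ k) • Pi.single k 1
            = Function.update s k (s k - s₀ k) := by
          funext i
          by_cases hik : i = k
          · subst hik
            simp
          · simp [hik]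
        have h3 := (hflat (s₀ k)).eq_integralCurve hF (hZc A)
          (η := fun t => g (t + s₀ k) (Function.update s k 0)) (T := s k - s₀ k)
          (((hg _ h1).comp_add (s₀ k)).isMIntegralCurveOn _) (by simp) h1
          (by rw [h2]; exact hupd s hs.1 _ hs.2)
        rw [h2] at h3
        rw [htr]
        simpa using h3
      refine IsFlat.congr_of_eventuallyEq ((hflat (s₀ k)).comp_add _ s₀ ?_) heq
      change -(s₀ k • Pi.single k 1) + s₀ ∈ Z A
      rw [htr]
      exact hupd s₀ hs₀ _ (by simpa using hε)

/-- Regularity propagates along a globally defined flat map. -/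
theorem IsFlat.mem_regFibre (hF : IsIntegrableSystem Ω F) {Φ : (Fin n → ℝ) → M}
    (hΦ : IsFlat Ω F Φ univ) {s₀ : Fin n → ℝ} (h₀ : Φ s₀ ∈ regFibre F) (s : Fin n → ℝ) :
    Φ s ∈ regFibre F := by
  refine ⟨?_, notMem_singSet_of_injective hF ?_⟩
  · rw [mem_preimage, hΦ.momentum_eq hF convex_univ (mem_univ s₀) (mem_univ s)]
    exact h₀.1
  · rw [injective_iff_map_eq_zero]
    intro c hc
    -- If `X_c` vanishes at `Φ s`, all multiples of `c` are periods of `Φ` at `s`, hence also at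
    -- `s₀`. Then `X_c` vanishes at the regular point `Φ s₀`, which forces `c = 0`.
    have hconst : ∀ t : ℝ, Φ (s + t • c) = Φ s := fun t =>
      (hΦ.eq_integralCurve hF convex_univ (η := fun _ => Φ s) (a := s) (T := t)
        ((isMIntegralCurve_const (v := combVF Ω F c) hc).isMIntegralCurveOn _) rfl (mem_univ _) (mem_univ _)).symm
    have hconst₀ : ∀ t : ℝ, Φ (s₀ + t • c) = Φ s₀ := fun t => by
      rw [add_comm]
      refine IsFlat.eqOn hF convex_univ ((hΦ.comp_add (t • c)).mono fun _ _ => mem_univ _) hΦ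
        (mem_univ s) ?_ (mem_univ s₀)
      rw [add_comm, hconst]
    have h1 := (hΦ.isMIntegralCurveOn s₀ c (S := univ) (fun _ _ => mem_univ _) 0
      (mem_univ 0)).hasMFDerivAt Filter.univ_mem
    have h2 : HasMFDerivAt 𝓘(ℝ, ℝ) 𝓘(ℝ, R2 n) (fun t : ℝ => Φ (s₀ + t • c)) 0
        (0 : ℝ →L[ℝ] R2 n) := by
      rw [funext hconst₀]
      exact hasMFDerivAt_const _ _
    have h3 := congrArg (fun L : ℝ →L[ℝ] R2 n => L 1) (hasMFDerivAt_unique h1 h2)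
    have h4 : (1 : ℝ) • (hamFrame Ω F (Φ (s₀ + (0 : ℝ) • c)) c : R2 n) = 0 := h3
    rw [one_smul, hconst₀] at h4
    exact hamFrame_injective hF h₀.2 (h4.trans (ContinuousLinearMap.map_zero _).symm)

theorem IsFlat.hamOrbit_subset_range (hF : IsIntegrableSystem Ω F) {Φ : (Fin n → ℝ) → M}
    (hΦ : IsFlat Ω F Φ univ) : hamOrbit Ω F (Φ 0) ⊆ range Φ := by
  intro q hq
  induction hq with
  | refl => exact mem_range_self 0
  | tail _ hstep ih =>
    obtain ⟨s, rfl⟩ := ih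
    obtain ⟨i, η, T, hη, h0, rfl⟩ := hstep
    have hVF : hamVF Ω (component F i) = combVF Ω F (Pi.single i 1) :=
      funext fun m => (hamFrame_single m i).symm
    rw [hVF] at hη
    exact ⟨_, (hΦ.eq_integralCurve hF convex_univ hη h0 (mem_univ _) (mem_univ _)).symm⟩

/-- A dense sequence, preceded by `0`, extends from `ℕ` to a continuous map on `ℝ` by Tietze. The
substitution `u ↦ 1/u - 1` sends `1` to `0` and `1/(k+2)` to `k + 1`. -/
theorem exists_continuousOn_Ioc_dense (n : ℕ) : ∃ c : ℝ → Fin n → ℝ,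
    ContinuousOn c (Ioc 0 1) ∧ c 1 = 0 ∧ Dense (c '' Ioc 0 1) := by
  let f : C(ℕ, Fin n → ℝ) := ⟨fun k => Nat.casesOn k 0 fun k => TopologicalSpace.denseSeq _ k,
    continuous_of_discreteTopology⟩
  obtain ⟨g, hg⟩ := f.exists_extension' Nat.isClosedEmbedding_coe_real
  have hgk : ∀ k : ℕ, g k = f k := fun k => congrFun hg k
  refine ⟨fun u => g (u⁻¹ - 1), ?_, ?_, ?_⟩
  · exact g.continuous.comp_continuousOn
      ((continuousOn_inv₀.mono fun u hu => hu.1.ne').sub continuousOn_const)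
  · have := hgk 0
    simpa [f] using this
  · refine (TopologicalSpace.denseRange_denseSeq (Fin n → ℝ)).mono ?_
    rintro _ ⟨k, rfl⟩
    refine ⟨((k + 2 : ℕ) : ℝ)⁻¹, ⟨by positivity, inv_le_one_of_one_le₀ ?_⟩, ?_⟩
    · exact_mod_cast Nat.le_add_left 1 (k + 1)
    · have := hgk (k + 1)
      have h1 : (((k + 2 : ℕ) : ℝ)⁻¹)⁻¹ - 1 = ((k + 1 : ℕ) : ℝ) := by
        rw [inv_inv]
        push_cast
        ring
      simp only [h1]
      exact this

end CompleteFlows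

/-! ### The theorem. -/

theorem mainTheorem8 {n : ℕ} [NeZero n] {M : Type*} [TopologicalSpace M] [T2Space M]
    [SecondCountableTopology M] [ChartedSpace (R2 n) M] [IsManifold 𝓘(ℝ, R2 n) ω M]
    (Ω : SymplecticForm n M) (F : M → Fin n → ℝ) (hF : IsIntegrableSystem Ω F)
    (m₀ : M) (hm₀ : F m₀ = 0) (hrank : rankAt F m₀ = 0)
    (γ : ℝ → M) (hγ : IsPiecewiseC1Loop (n := n) γ)
    (hγreg : ∀ t ∈ Icc (0 : ℝ) 1, γ t ∈ regFibre F)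
    (ha : loopIntegral Ω F 0 γ ≠ 0)
    (m₁ : M) (hm₁ : m₁ ∈ γ '' Icc 0 1)
    (hb : (FlowsCompleteInZeroFibre Ω F ∧ m₀ ∈ closure (hamOrbit Ω F m₁)) ∨
      ∃ (r : ℝ) (φ : OpenPartialHomeomorph M (R2 n)) (c : ℝ) (p : ℝ → M),
        IsCanonicalChart Ω m₀ r φ ∧
        0 < c ∧
        (∀ x ∈ Metric.ball (0 : R2 n) r, ∀ i : Fin n,
          ‖fderiv ℝ (fun y => component F i (φ.symm y)) x‖ ≤ c * ‖x‖) ∧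
        ContinuousOn p (Ioc 0 1) ∧
        (∀ u ∈ Ioc (0 : ℝ) 1, p u ∈ regFibre F ∧ p u ∈ φ.source ∧
          φ (p u) ∈ Metric.ball (0 : R2 n) (r * Real.exp (-(n * c * loopLength Ω F γ)))) ∧
        p 1 = m₁ ∧
        m₀ ∈ closure (p '' Ioc 0 1)) :
    ∃ a : Fin n → ℝ, a 0 ≠ 0 ∧ PeriodicityCondition Ω (replaceFirst F a) m₀ m₁ := by
  obtain ⟨t₁, ht₁, rfl⟩ := hm₁
  have hw : (∫ t in (0 : ℝ)..1, frameSpeed Ω F γ t) 0 ≠ 0 := by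
    rwa [← hγ.loopIntegral_eq hF hγreg]
  have hwℓ := hγ.norm_integral_le_loopLength hF hγreg (left_mem_Icc.2 zero_le_one)
    (right_mem_Icc.2 zero_le_one)
  have h1 : (1 : ℝ) ∈ Ioc (0 : ℝ) 1 := ⟨zero_lt_one, le_rfl⟩
  rcases hb with ⟨hcomp, hm⟩ | ⟨r, φ, c, p, hφ, hc, hbd, hp, hpφ, hp1, hm⟩
  · obtain ⟨Φ, hΦ0, hΦ⟩ := hcomp.exists_isFlat_univ hF (hγreg t₁ ht₁).1
    have hΦc : Continuous Φ := continuous_iff_continuousAt.2 fun s => hΦ.continuousAt (mem_univ s)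
    -- The path `Φ ∘ c` is dense in the orbit of `m₁`, so it accumulates at `m₀`.
    obtain ⟨c, hc, hc1, hcd⟩ := exists_continuousOn_Ioc_dense n
    have hflat : ∀ u, IsFlat Ω F (fun s => Φ (c u + s))
        (Metric.ball 0 (loopLength Ω F γ + 1)) := fun u =>
      (hΦ.comp_add (c u)).mono fun _ _ => mem_univ _
    have hΦ1 : Φ (c 1) = γ t₁ := by rw [hc1, hΦ0]
    refine periodicityCondition_of_path hF hrank (p := fun u => Φ (c u))
      (hΦc.comp_continuousOn hc) (Φ := fun u s => Φ (c u + s))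
      (ρ := fun _ => loopLength Ω F γ + 1) hw (fun _ _ => hwℓ.trans_lt (lt_add_one _))
      (fun u _ => hflat u)
      (fun u _ => hΦ.mem_regFibre hF (s₀ := 0) (by rw [hΦ0]; exact hγreg t₁ ht₁) _)
      (fun u _ => by rw [add_zero]) hΦ1 ?_ ?_
    · have := hγ.flat_period hF hγreg (hflat 1) (lt_add_one _) ht₁ (by rw [add_zero, hΦ1])
      rw [this, add_zero, hΦ1]
    · have h2 : range Φ ⊆ closure (Φ '' (c '' Ioc 0 1)) := by
        rw [← image_univ, ← hcd.closure_eq]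
        exact image_closure_subset_closure_image hΦc
      rw [image_image] at h2
      rw [← hΦ0] at hm
      exact closure_minimal ((hΦ.hamOrbit_subset_range hF).trans h2) isClosed_closure hm
  · have hex : ∀ u ∈ Ioc (0 : ℝ) 1, ∃ ρ Φ, loopLength Ω F γ < ρ ∧ Φ 0 = p u ∧
        IsFlat Ω F Φ (Metric.ball 0 ρ) := by
      intro u hu
      obtain ⟨-, hsrc, hlt⟩ := hpφ u hu
      have hℓ : ‖φ (p u)‖ * Real.exp (n * c * loopLength Ω F γ) < r := by
        rw [mem_ball_zero_iff, Real.exp_neg, ← div_eq_mul_inv, lt_div_iff₀ (Real.exp_pos _)] at hlt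
        exact hlt
      -- The chart bound is strict at `ρ = ℓ`, so it persists for some `ρ > ℓ`, as the lifting of
      -- the loop requires.
      have hcont : ContinuousAt (fun ρ => ‖φ (p u)‖ * Real.exp (n * c * ρ)) (loopLength Ω F γ) := by
        fun_prop
      obtain ⟨ρ, hρ, hρℓ⟩ := (((hcont.eventually_lt_const hℓ).filter_mono
        nhdsWithin_le_nhds).and (self_mem_nhdsWithin : Ioi (loopLength Ω F γ) ∈ 𝓝[>] _)).exists
      obtain ⟨Φ, hΦ0, hΦ⟩ := hφ.exists_isFlat hF hc.le hbd hsrc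
        (((norm_nonneg _).trans hwℓ).trans_lt hρℓ) hρ
      exact ⟨ρ, Φ, hρℓ, hΦ0, hΦ⟩
    have : Nonempty M := ⟨m₀⟩
    choose! ρ Φ hρ hΦ0 hΦ using hex
    refine periodicityCondition_of_path hF hrank hp hw (fun u hu => hwℓ.trans_lt (hρ u hu)) hΦ
      (fun u hu => (hpφ u hu).1) hΦ0 hp1 ?_ hm
    have h2 := (hΦ0 1 h1).trans hp1
    rw [hγ.flat_period hF hγreg (hΦ 1 h1) (hρ 1 h1) ht₁ h2, h2]
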